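/- **Setting.** Let $G$ be a countable infinite discrete group. Let $\mathcal T=(C_n,F_{n-1},\kappa_n,\nu_{n-1})_{n\ge 1}$ consist of finite subsets $F_n, C_n$ of $G$, non-degenerate probability measures $\kappa_n$ on $C_n$ and non-degenerate finite measures $\nu_n$ on $F_n$ (non-degenerate: every point of the set has positive mass) such that: * $F_0=\{1\}$ and, for all $n\ge 0$, $1\in F_n\cap C_{n+1}$, $\#C_{n+1}>1$, $F_nC_{n+1}\subset F_{n+1}$, and $F_nc\cap F_nc'=\emptyset$ for distinct $c,c'\in C_{n+1}$; * $\prod_{n\ge1}\max_{c\in C_n}\kappa_n(c)=0$; $\nu_0$ is the Dirac measure at $1$; $\nu_{n+1}(fc)=\nu_n(f)\kappa_{n+1}(c)$ for $f\in F_n$, $c\in C_{n+1}$, $n\ge 0$; * $\lim_{m\to\infty}\nu_m\big((F_nC_{n+1}\cdots C_m)\cap g^{-1}F_m\big)=\nu_n(F_n)$ for all $g\in G$, $n\ge0$; * $\lim_{n\to\infty}\nu_n(F_n)<\infty$. Let $X_n=F_n\times C_{n+1}\times C_{n+2}\times\cdots$ with the product topology, and let $X$ be the topological inductive limit of $X_0\to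 X_1\to\cdots$ under the embeddings $(f_n,c_{n+1},c_{n+2},\dots)\mapsto(f_nc_{n+1},c_{n+2},\dots)$, with its Borel $\sigma$-algebra. Let $\mu$ be the measure on $X$ with $\mu|_{X_n}=\nu_n\otimes\kappa_{n+1}\otimes\kappa_{n+2}\otimes\cdots$ for all $n$; it is finite. Let $X^G$ be the set of $x\in X$ such that for each $g\in G$ there is $n$ with $x=(f_n,c_{n+1},\dots)\in X_n$ and $gf_n\in F_n$; it is $\mu$-conull. For such $x$, $g$, $n$ put $T_gx=(gf_n,c_{n+1},c_{n+2},\dots)$ (outside $X^G$, put $T_gx=x$). Then $(X,\mu,T)$ is the nonsingular $(C,F)$-action associated with $\mathcal T$. For $n<m$ let $C_{n+1,m}=C_{n+1}\cdots C_m$ and $\kappa_{n+1,m}=\kappa_{n+1}*\cdots*\kappa_m$. For a strictly increasing integer sequence $\boldsymbol l=(l_n)_{n\ge0}$ with $l_0=0$, the $\boldsymbol l$-telescoping of $\mathcal T$ is $\widetilde{\mathcal T}=(\widetilde C_n,\widetilde F_{n-1},\widetilde\kappa_n,\widetilde\nu_{n-1})_{n\ge1}$ with $\widetilde F_n=F_{l_n}$,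 $\widetilde\nu_n=\nu_{l_n}$, $\widetilde C_{n+1}=C_{l_n+1,l_{n+1}}$, $\widetilde\kappa_{n+1}=\kappa_{l_n+1,l_{n+1}}$. With $\widetilde X$ its space, $\iota_{\boldsymbol l}:X\to\widetilde X$ is the canonical isomorphism: for the smallest $n$ with $x=(f,c_{l_n+1},c_{l_n+2},\dots)\in X_{l_n}$, $\iota_{\boldsymbol l}(x)=(f,\,c_{l_n+1}\cdots c_{l_{n+1}},\,c_{l_{n+1}+1}\cdots c_{l_{n+2}},\dots)\in\widetilde X_n$. Let $\Gamma$ be a subgroup of finite index in $G$; $G$ acts on the discrete space $G/\Gamma$ by left translations. For $g\in G$, $\mathcal T$ is compatible with $g\Gamma$ if $\sum_{n\ge1}\kappa_n(\{c\in C_n: c\notin g\Gamma g^{-1}\})<\infty$. For $x=(f_n,c_{n+1},\dots)\in X_n$ let $\pi_{(\mathcal T,g\Gamma)}(x)=\lim_{m\to\infty}f_nc_{n+1}\cdots c_m\,g\Gamma\in G/\Gamma$ where this limit exists (an arbitrary fixed value elsewhere). These notions apply also to telescopings. A measurable map $\tau$ from $X$ to a measurable $G$-space is called a factor map if for each $g\in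 G$, $\tau(T_gx)=g\tau(x)$ for $\mu$-a.e. $x$. **Theorem.** (A) The following are equivalent. 1. There is a factor map $\tau:X\to G/\Gamma$. 2. There is a sequence $(g_n)$ in $G$ such that $\displaystyle\lim_{N\to\infty}\ \sup_{m>n\ge N}\kappa_{n+1,m}\big(\{c\in C_{n+1,m}: c\notin g_n^{-1}\Gamma g_m\}\big)=0.$ 3. There are $g_0\in G$ and a telescoping of $\mathcal T$ which is compatible with $g_0\Gamma$. (B) If $g_0\in G$ and the $\boldsymbol q$-telescoping $\widetilde{\mathcal T}$ of $\mathcal T$ is compatible with $g_0\Gamma$, then the limit defining $\pi_{(\widetilde{\mathcal T},g_0\Gamma)}(\iota_{\boldsymbol q}(x))$ exists for $\mu$-a.e. $x\in X$, and $\pi_{(\widetilde{\mathcal T},g_0\Gamma)}\circ\iota_{\boldsymbol q}$ is a factor map $X\to G/\Gamma$. (C) For every factor map $\tau:X\to G/\Gamma$ there are $g_0\in G$ and $\boldsymbol q$ such that the $\boldsymbol q$-telescoping $\widetilde{\mathcal T}$ of $\mathcal T$ is compatible with $g_0\Gamma$ and $\tau=\pi_{(\widetilde{\mathcal T},g_0\Gamma)}\circ\iota_{\boldsymbol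 q}$ $\mu$-almost everywhere. (D) $T$ has no factor isomorphic to $G/\Gamma$ (that is, there is no factor map from $X$ to a measurable $G$-space isomorphic to $G/\Gamma$) if and only if for no $g\in G$ there is a telescoping of $\mathcal T$ compatible with $g\Gamma g^{-1}$ (the trivial coset of this subgroup). -/

import Mathlib

open Set Filter Topology MeasureTheory
open scoped Pointwise ENNReal

universe u

/-- `listProd a n m = a n * a (n+1) * ⋯ * a (m-1)`, in this order (the empty product if `m ≤ n`).
It is used for elements of a group and for subsets of a group (with the setwise product). -/
def listProd {M : Type*} [Monoid M] (a : ℕ → M) (n m : ℕ) : M :=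
  ((List.Ico n m).map a).prod

lemma listProd_self {M : Type*} [Monoid M] (a : ℕ → M) (n : ℕ) : listProd a n n = 1 := by
  simp [listProd]

lemma listProd_succ {M : Type*} [Monoid M] (a : ℕ → M) {n m : ℕ} (h : n ≤ m) :
    listProd a n (m + 1) = listProd a n m * a m := by
  simp [listProd, List.Ico.succ_top h]

/-- The convolution `κ n * κ (n+1) * ⋯ * κ (m-1)` of measures on `G`
(the Dirac measure at `1` if `m ≤ n`). -/
noncomputable def convProd {G : Type*} [Monoid G] [MeasurableSpace G]
    (κ : ℕ → Measure G) (n m : ℕ) : Measure G :=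
  ((List.Ico n m).map κ).foldl (fun μ ν => μ.mconv ν) (Measure.dirac 1)

/-- A sequence of finite subsets `F 0, F 1, …` and `C₁, C₂, …` of `G` as in the `(C,F)`-construction.
The sequence `C₁, C₂, …` is indexed from `0`: the set `C n` below is the set usually
denoted `C_{n+1}`, so that `F n * C n ⊆ F (n+1)`. -/
structure CFSeq (G : Type u) [Group G] where
  F : ℕ → Set G
  C : ℕ → Set G
  finite_F : ∀ n, (F n).Finite
  finite_C : ∀ n, (C n).Finite
  F_zero : F 0 = {1}
  one_mem_F : ∀ n, 1 ∈ F n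
  one_mem_C : ∀ n, 1 ∈ C n
  /-- `C n` has more than one element. -/
  nontrivial_C : ∀ n, (C n).Nontrivial
  mul_subset : ∀ n, F n * C n ⊆ F (n + 1)
  disjoint : ∀ n, ∀ c ∈ C n, ∀ c' ∈ C n, c ≠ c' → Disjoint (F n * {c}) (F n * {c'})

namespace CFSeq

variable {G : Type u} [Group G]

/-! ### The space of a `(C,F)`-sequence -/

/-- The set `X_n = F_n × C_{n+1} × C_{n+2} × ⋯` as a set of pairs
`(f, (c 0, c 1, …))` with `f ∈ F_n` and `c i ∈ C_{n+1+i}`. -/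
def levelSet (S : CFSeq G) (n : ℕ) : Set (G × (ℕ → G)) :=
  {p | p.1 ∈ S.F n ∧ ∀ i, p.2 i ∈ S.C (n + i)}

/-- `X_n` as a type; when `G` is a discrete space it carries the product topology. -/
abbrev Level (S : CFSeq G) (n : ℕ) : Type u := S.levelSet n

/-- The embedding `X_n → X_{n+1}`, `(f, c_{n+1}, c_{n+2}, …) ↦ (f c_{n+1}, c_{n+2}, …)`. -/
def embed (S : CFSeq G) (n : ℕ) (p : S.Level n) : S.Level (n + 1) :=
  ⟨(p.1.1 * p.1.2 0, fun i => p.1.2 (i + 1)),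
    S.mul_subset n (Set.mul_mem_mul p.2.1 (p.2.2 0)),
    fun i => by
      have h := p.2.2 (i + 1)
      have e : n + 1 + i = n + (i + 1) := by omega
      simpa only [e] using h⟩

/-- The inductive limit `X` of the sequence `X_0 → X_1 → X_2 → ⋯`: the quotient of the disjoint union
of the `X_n` by the equivalence relation generated by `p ∼ embed p`. -/
def Space (S : CFSeq G) : Type u :=
  Quot (fun a b : (Σ n, S.Level n) => b = ⟨a.1 + 1, S.embed a.1 a.2⟩)

/-- The canonical map `X_n → X`. -/
def incl (S : CFSeq G) (n : ℕ) (p : S.Level n) : S.Space := Quot.mk _ ⟨n, p⟩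

/-- The topology of the inductive limit. -/
instance [TopologicalSpace G] (S : CFSeq G) : TopologicalSpace S.Space :=
  inferInstanceAs (TopologicalSpace (Quot _))

/-- `X` carries its Borel `σ`-algebra. -/
instance [TopologicalSpace G] (S : CFSeq G) : MeasurableSpace S.Space := borel _

instance [TopologicalSpace G] (S : CFSeq G) : BorelSpace S.Space := ⟨rfl⟩

lemma incl_embed (S : CFSeq G) (n : ℕ) (p : S.Level n) :
    S.incl (n + 1) (S.embed n p) = S.incl n p :=
  (Quot.sound (r := fun a b : (Σ n, S.Level n) => b = ⟨a.1 + 1, S.embed a.1 a.2⟩)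
    (a := ⟨n, p⟩) rfl).symm

lemma range_incl_mono (S : CFSeq G) : Monotone fun n => range (S.incl n) := by
  refine monotone_nat_of_le_succ fun n => ?_
  rintro _ ⟨p, rfl⟩
  exact ⟨S.embed n p, S.incl_embed n p⟩

/-! ### The topological `(C,F)`-action -/

/-- The set `X^g`: the points `x = (f_n, c_{n+1}, …)` with `g f_n ∈ F_n` for some `n`. -/
def domain (S : CFSeq G) (g : G) : Set S.Space :=
  {x | ∃ (n : ℕ) (p : S.Level n), x = S.incl n p ∧ g * p.1.1 ∈ S.F n}

/-- The set `X^G = ⋂ g, X^g`. -/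
def fullDomain (S : CFSeq G) : Set S.Space := ⋂ g, S.domain g

open Classical in
/-- The `(C,F)`-action on `X^G`: `T_g (f_n, c_{n+1}, …) = (g f_n, c_{n+1}, …)` for any `n` with
`x = (f_n, c_{n+1}, …) ∈ X_n` and `g f_n ∈ F_n`. The points outside `X^G` are left fixed. -/
noncomputable def act (S : CFSeq G) (g : G) (x : S.Space) : S.Space :=
  if h : x ∈ S.fullDomain then
    let h' := mem_iInter.1 h g
    S.incl h'.choose ⟨(g * h'.choose_spec.choose.1.1, h'.choose_spec.choose.1.2),
      h'.choose_spec.choose_spec.2, h'.choose_spec.choose.2.2⟩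
  else x

/-! ### Telescopings -/

/-- `C_{n+1} C_{n+2} ⋯ C_m`. -/
def Cprod (S : CFSeq G) (n m : ℕ) : Set G := listProd S.C n m

lemma Cprod_self (S : CFSeq G) (n : ℕ) : S.Cprod n n = {1} := by
  rw [Cprod, listProd_self, Set.singleton_one]

lemma Cprod_succ (S : CFSeq G) {n m : ℕ} (h : n ≤ m) :
    S.Cprod n (m + 1) = S.Cprod n m * S.C m := listProd_succ _ h

lemma finite_Cprod (S : CFSeq G) {n m : ℕ} (h : n ≤ m) : (S.Cprod n m).Finite := by
  induction m, h using Nat.le_induction with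
  | base => simp [Cprod_self]
  | succ m h ih => rw [S.Cprod_succ h]; exact ih.mul (S.finite_C m)

lemma one_mem_Cprod (S : CFSeq G) {n m : ℕ} (h : n ≤ m) : (1 : G) ∈ S.Cprod n m := by
  induction m, h using Nat.le_induction with
  | base => simp [Cprod_self]
  | succ m h ih =>
    rw [S.Cprod_succ h]
    exact ⟨1, ih, 1, S.one_mem_C m, by simp⟩

lemma nontrivial_Cprod (S : CFSeq G) {n m : ℕ} (h : n < m) : (S.Cprod n m).Nontrivial := by
  obtain ⟨m, rfl⟩ : ∃ k, m = k + 1 := ⟨m - 1, by omega⟩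
  have h' : n ≤ m := by omega
  rw [S.Cprod_succ h']
  exact (S.nontrivial_C m).mono fun c hc => ⟨1, S.one_mem_Cprod h', c, hc, by simp⟩

lemma mul_Cprod_subset (S : CFSeq G) {n m : ℕ} (h : n ≤ m) : S.F n * S.Cprod n m ⊆ S.F m := by
  induction m, h using Nat.le_induction with
  | base => simp [Cprod_self]
  | succ m h ih =>
    rw [S.Cprod_succ h, ← mul_assoc]
    exact (Set.mul_subset_mul_right ih).trans (S.mul_subset m)

lemma Cprod_inj (S : CFSeq G) {n m : ℕ} (h : n ≤ m) :
    ∀ f ∈ S.F n, ∀ f' ∈ S.F n, ∀ c ∈ S.Cprod n m, ∀ c' ∈ S.Cprod n m,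
      f * c = f' * c' → c = c' := by
  induction m, h using Nat.le_induction with
  | base =>
    intro f _ f' _ c hc c' hc' _
    rw [Cprod_self] at hc hc'
    exact hc.trans hc'.symm
  | succ m h ih =>
    intro f hf f' hf' c hc c' hc' e
    rw [S.Cprod_succ h] at hc hc'
    obtain ⟨a, ha, b, hb, rfl⟩ := hc
    obtain ⟨a', ha', b', hb', rfl⟩ := hc'
    simp only [← mul_assoc] at e
    have h1 := S.mul_Cprod_subset h (Set.mul_mem_mul hf ha)
    have h2 := S.mul_Cprod_subset h (Set.mul_mem_mul hf' ha')
    have hbb : b = b' := by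
      by_contra hne
      refine Set.disjoint_left.1 (S.disjoint m b hb b' hb' hne)
        (Set.mul_mem_mul h1 (mem_singleton b)) ?_
      rw [e]
      exact Set.mul_mem_mul h2 (mem_singleton b')
    subst hbb
    rw [ih f hf f' hf' a ha a' ha' (mul_right_cancel e)]

end CFSeq

/-- The sequences `0 = l 0 < l 1 < l 2 < ⋯` along which one telescopes. -/
structure IsTelescopingSeq (l : ℕ → ℕ) : Prop where
  zero : l 0 = 0
  strictMono : StrictMono l

namespace CFSeq

variable {G : Type u} [Group G]

/-- The `l`-telescoping: `F̃_n = F_{l_n}` and `C̃_{n+1} = C_{l_n+1} ⋯ C_{l_{n+1}}`. -/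
def telescope (S : CFSeq G) (l : ℕ → ℕ) (hl : IsTelescopingSeq l) : CFSeq G where
  F n := S.F (l n)
  C n := S.Cprod (l n) (l (n + 1))
  finite_F n := S.finite_F _
  finite_C n := S.finite_Cprod (hl.strictMono n.lt_succ_self).le
  F_zero := by rw [hl.zero, S.F_zero]
  one_mem_F n := S.one_mem_F _
  one_mem_C n := S.one_mem_Cprod (hl.strictMono n.lt_succ_self).le
  nontrivial_C n := S.nontrivial_Cprod (hl.strictMono n.lt_succ_self)
  mul_subset n := S.mul_Cprod_subset (hl.strictMono n.lt_succ_self).le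
  disjoint n c hc c' hc' hne := by
    rw [Set.disjoint_left]
    rintro x ⟨f, hf, _, rfl, rfl⟩ ⟨f', hf', _, rfl, e⟩
    exact hne (S.Cprod_inj (hl.strictMono n.lt_succ_self).le f hf f' hf' _ hc _ hc' e.symm)

lemma listProd_mem_Cprod (S : CFSeq G) (k : ℕ) (c : ℕ → G) (hc : ∀ i, c i ∈ S.C (k + i))
    {a b : ℕ} (h : a ≤ b) : listProd c a b ∈ S.Cprod (k + a) (k + b) := by
  induction b, h using Nat.le_induction with
  | base => simp [Cprod_self, listProd_self]
  | succ b h ih =>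
    rw [listProd_succ c h, ← add_assoc, S.Cprod_succ (by omega)]
    exact Set.mul_mem_mul ih (hc b)

/-- The map `X_{l_n} → X̃_n`,
`(f, c_{l_n+1}, c_{l_n+2}, …) ↦ (f, c_{l_n+1} ⋯ c_{l_{n+1}}, c_{l_{n+1}+1} ⋯ c_{l_{n+2}}, …)`. -/
def telescopeLevel (S : CFSeq G) (l : ℕ → ℕ) (hl : IsTelescopingSeq l) (n : ℕ)
    (p : S.Level (l n)) : (S.telescope l hl).Level n :=
  ⟨(p.1.1, fun i => listProd p.1.2 (l (n + i) - l n) (l (n + i + 1) - l n)), p.2.1, fun i => by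
    have h1 : l n ≤ l (n + i) := hl.strictMono.monotone (by omega)
    have h2 : l (n + i) ≤ l (n + i + 1) := hl.strictMono.monotone (by omega)
    have h := S.listProd_mem_Cprod (l n) p.1.2 p.2.2
      (show l (n + i) - l n ≤ l (n + i + 1) - l n by omega)
    rwa [show l n + (l (n + i) - l n) = l (n + i) by omega,
      show l n + (l (n + i + 1) - l n) = l (n + i + 1) by omega] at h⟩

lemma exists_rep (S : CFSeq G) (l : ℕ → ℕ) (hl : IsTelescopingSeq l) (x : S.Space) :
    ∃ n, ∃ p : S.Level (l n), S.incl (l n) p = x := by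
  induction x using Quot.ind with
  | mk a =>
    obtain ⟨m, p⟩ := a
    exact ⟨m, S.range_incl_mono (hl.strictMono.le_apply (x := m)) ⟨p, rfl⟩⟩

open Classical in
/-- The canonical identification `ι_l : X → X̃` of the space of `S` with that of its `l`-telescoping:
take the smallest `n` with `x ∈ X_{l_n}` and group the coordinates of `x` in `X_{l_n}`. -/
noncomputable def iota (S : CFSeq G) (l : ℕ → ℕ) (hl : IsTelescopingSeq l) (x : S.Space) :
    (S.telescope l hl).Space :=
  (S.telescope l hl).incl (Nat.find (S.exists_rep l hl x))
    (S.telescopeLevel l hl _ (Nat.find_spec (S.exists_rep l hl x)).choose)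

/-! ### The explicit map to a coset space -/

/-- `S.IsFactorValue q x j` says that, for `x = (f_n, c_{n+1}, c_{n+2}, …) ∈ X_n`, the limit of
`f_n c_{n+1} ⋯ c_m q` as `m → ∞` exists in the coset space `G ⧸ Γ` and is equal to `j`
(`G` is discrete, hence so is `G ⧸ Γ`). -/
def IsFactorValue [TopologicalSpace G] (S : CFSeq G) {Γ : Subgroup G} (q : G ⧸ Γ)
    (x : S.Space) (j : G ⧸ Γ) : Prop :=
  ∃ (n : ℕ) (p : S.Level n), x = S.incl n p ∧
    Tendsto (fun m => (p.1.1 * listProd p.1.2 0 m) • q) atTop (𝓝 j)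

open Classical in
/-- The map `x ↦ lim f_n c_{n+1} ⋯ c_m q`. Where the limit does not exist,
the value is the irrelevant coset `q`. -/
noncomputable def factorMap [TopologicalSpace G] (S : CFSeq G) {Γ : Subgroup G} (q : G ⧸ Γ)
    (x : S.Space) : G ⧸ Γ :=
  if h : ∃ j, S.IsFactorValue q x j then h.choose else q

end CFSeq

/-- A sequence `𝒯 = (C_n, F_{n-1}, κ_n, ν_{n-1})_{n ≥ 1}`. As for `C`, the measure `κ n` is the
one usually denoted `κ_{n+1}`. The conditions on the measures are in `CFData.Admissible`. -/
structure CFData (G : Type u) [Group G] [MeasurableSpace G] extends CFSeq G where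
  κ : ℕ → Measure G
  ν : ℕ → Measure G

namespace CFData

variable {G : Type u} [Group G] [MeasurableSpace G]

/-- The conditions on the measures of a sequence `𝒯` that defines a nonsingular `(C,F)`-action. -/
structure Admissible (D : CFData G) : Prop where
  /-- `κ n` is a non-degenerate probability measure on `C n`. -/
  prob_κ : ∀ n, IsProbabilityMeasure (D.κ n)
  supp_κ : ∀ n, D.κ n (D.C n)ᶜ = 0
  pos_κ : ∀ n, ∀ c ∈ D.C n, 0 < D.κ n {c}
  /-- `ν n` is a non-degenerate finite measure on `F n`. -/
  fin_ν : ∀ n, IsFiniteMeasure (D.ν n)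
  supp_ν : ∀ n, D.ν n (D.F n)ᶜ = 0
  pos_ν : ∀ n, ∀ f ∈ D.F n, 0 < D.ν n {f}
  ν_zero : D.ν 0 = Measure.dirac 1
  /-- `∏_n max_{c ∈ C_n} κ_n(c) = 0`, i.e. the measure `μ` below is non-atomic. -/
  nonatomic : Tendsto (fun N => ∏ n ∈ Finset.range N, ⨆ c ∈ D.C n, D.κ n {c}) atTop (𝓝 0)
  ν_mul : ∀ n, ∀ f ∈ D.F n, ∀ c ∈ D.C n, D.ν (n + 1) {f * c} = D.ν n {f} * D.κ n {c}
  /-- `lim_m ν_m((F_n C_{n+1} ⋯ C_m) ∩ g⁻¹ F_m) = ν_n(F_n)` for all `g` and `n`,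
  i.e. the complement of `X^G` has measure zero. -/
  full : ∀ (g : G) (n : ℕ),
    Tendsto (fun m => D.ν m ((D.F n * D.Cprod n m) ∩ g⁻¹ • D.F m)) atTop (𝓝 (D.ν n (D.F n)))

/-- `κ_{n+1} * κ_{n+2} * ⋯ * κ_m`, the measure usually denoted `κ_{n+1,m}`. -/
noncomputable def κprod (D : CFData G) (n m : ℕ) : Measure G := convProd D.κ n m

/-- The `l`-telescoping of `𝒯`. -/
noncomputable def telescope (D : CFData G) (l : ℕ → ℕ) (hl : IsTelescopingSeq l) : CFData G where
  toCFSeq := D.toCFSeq.telescope l hl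
  κ n := D.κprod (l n) (l (n + 1))
  ν n := D.ν (l n)

/-- `𝒯` is compatible with the coset `g Γ`: `∑_n κ_n {c ∈ C_n | c ∉ g Γ g⁻¹} < ∞`. -/
def CompatibleWith (D : CFData G) (Γ : Subgroup G) (g : G) : Prop :=
  ∑' n, D.κ n {c ∈ D.C n | c ∉ Γ.map (MulAut.conj g).toMonoidHom} < ∞

/-- The measure `ν_n ⊗ κ_{n+1} ⊗ κ_{n+2} ⊗ ⋯` on `X_n`. -/
noncomputable def levelMeasure (D : CFData G) (n : ℕ) : Measure (D.Level n) :=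
  ((D.ν n).prod (Measure.infinitePi fun i => D.κ (n + i))).comap Subtype.val

variable [TopologicalSpace G]

/-- The nonsingular `(C,F)`-measure `μ` on `X`: on `X_n ∖ X_{n-1}` it is the image of
`ν_n ⊗ κ_{n+1} ⊗ κ_{n+2} ⊗ ⋯`. -/
noncomputable def μ (D : CFData G) : Measure D.Space :=
  Measure.sum fun n => ((D.levelMeasure n).map (D.incl n)).restrict
    (disjointed (fun k => range (D.incl k)) n)

/-- A measurable map `φ` from `X` to a measurable `G`-space which is equivariant `μ`-a.e. -/
def IsFactorMap (D : CFData G) {Y : Type*} [MeasurableSpace Y] [MulAction G Y]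
    (φ : D.Space → Y) : Prop :=
  Measurable φ ∧ ∀ g : G, ∀ᵐ x ∂D.μ, φ (D.act g x) = g • φ x

/-- The `(C,F)`-action associated with `𝒯` has a factor isomorphic to `G ⧸ Γ`. -/
def HasFactorIsomorphicTo (D : CFData G) (Γ : Subgroup G) : Prop :=
  ∃ (Y : Type u) (_ : MeasurableSpace Y) (_ : MulAction G Y) (φ : D.Space → Y) (e : Y ≃ᵐ G ⧸ Γ),
    D.IsFactorMap φ ∧ ∀ (g : G) (y : Y), e (g • y) = g • e y

end CFData

/-! Let `τ` be a factor map and `θ_n = baseMap τ n` its restriction to `{1} × C_{n+1} × ⋯`.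
Equivariance gives, almost surely, `τ(f, c) = f θ_n(c)` and `θ_n(c) = c_{n+1} ⋯ c_m θ_m(tail of c)`.
The crux is that `θ_m` is almost constant for large `m`. Indeed `θ_0` is a measurable function on a
product space with values in the finite set `G ⧸ Γ`, so it is almost determined by the first `m`
coordinates: resampling the later ones independently changes it with probability tending to `0`
(`tendsto_measure_splice_ne`). The old and the new value are translates, by the same element `c_1 ⋯
c_m`, of `θ_m` at two independent tails. Hence these two values of `θ_m` agree with probability
close to `1`, and `θ_m` is close to a constant `j_m` (`Admissible.exists_tendsto_baseMap_ne`).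

Consequently `c_{n+1} ⋯ c_m` maps `j_m` to `j_n` outside a set of small measure, which is condition
2 (`Admissible.κprod_smul_ne_le`). As `G ⧸ Γ` is finite, some coset `g Γ` occurs infinitely often
among the `j_n`; telescoping along such indices with summable errors gives compatibility with `g Γ`,
and Borel–Cantelli identifies `τ` with the limit map (`Admissible.exists_compatibleWith_ae_eq`). The
same pigeonhole argument leads from condition 2 to condition 3.

Conversely, under compatibility, Borel–Cantelli shows that almost surely all but finitely many
blocks fix `g Γ`, so the partial products applied to `g Γ` stabilise
(`Admissible.ae_exists_isFactorValue`). The limit is equivariant because the action multiplies the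
first coordinate on the left. Statements about almost every point of `X` are transferred to the
product measures by `Admissible.ae_μ_iff`. -/

/-! ### Product measures on sequences and resampling of tails -/

namespace MeasureTheory.Measure

variable {α : Type*} [MeasurableSpace α]

/-- A measure on sequences is the product measure as soon as it has the right values on the
cylinders over all sufficiently long initial segments. -/
lemma eq_infinitePi_of_range (κ : ℕ → Measure α) [∀ i, IsProbabilityMeasure (κ i)]
    {ρ : Measure (ℕ → α)} (m : ℕ)
    (h : ∀ (N : ℕ) (t : ℕ → Set α), (∀ i, MeasurableSet (t i)) →
      ρ ((Finset.range (m + N) : Set ℕ).pi t) = ∏ i ∈ Finset.range (m + N), κ i (t i)) :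
    ρ = infinitePi κ := by
  classical
  refine eq_infinitePi κ fun s t ht => ?_
  have hs : s ⊆ Finset.range (m + (s.sup id + 1)) := fun i hi => by
    have := Finset.le_sup (f := id) hi
    simp only [id, Finset.mem_range] at this ⊢
    omega
  have key := h (s.sup id + 1) (fun i => if i ∈ s then t i else univ)
    fun i => by split_ifs <;> simp [ht]
  have e1 : (Finset.range (m + (s.sup id + 1)) : Set ℕ).pi (fun i => if i ∈ s then t i else univ)
      = (s : Set ℕ).pi t := by
    ext x
    simp only [Set.mem_pi, Finset.mem_coe]
    refine ⟨fun H i hi => by simpa [hi] using H i (hs hi), fun H i _ => ?_⟩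
    split_ifs with hi
    · exact H i hi
    · trivial
  rw [e1] at key
  rw [key, ← Finset.prod_subset hs]
  · exact Finset.prod_congr rfl fun i hi => by simp [hi]
  · intro i _ hi
    simp [hi]

end MeasureTheory.Measure

/-- The sequence `c 0, …, c (m-1), c' 0, c' 1, …`. -/
def splice {α : Type*} (m : ℕ) (c c' : ℕ → α) : ℕ → α := fun i => if i < m then c i else c' (i - m)

lemma splice_of_lt {α : Type*} {m i : ℕ} (h : i < m) (c c' : ℕ → α) : splice m c c' i = c i :=
  if_pos h

lemma splice_add {α : Type*} (m i : ℕ) (c c' : ℕ → α) : splice m c c' (m + i) = c' i := by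
  simp [splice]

section Splice

variable {α : Type*} [MeasurableSpace α]

lemma measurable_splice (m : ℕ) :
    Measurable fun p : (ℕ → α) × (ℕ → α) => splice m p.1 p.2 := by
  refine measurable_pi_lambda _ fun i => ?_
  unfold splice
  split_ifs <;> fun_prop

open Measure in
lemma measurePreserving_splice (κ : ℕ → Measure α) [∀ i, IsProbabilityMeasure (κ i)] (m : ℕ) :
    MeasurePreserving (fun p : (ℕ → α) × (ℕ → α) => splice m p.1 p.2)
      ((infinitePi κ).prod (infinitePi fun i => κ (m + i))) (infinitePi κ) := by
  refine ⟨measurable_splice m, eq_infinitePi_of_range κ m fun N t ht => ?_⟩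
  rw [map_apply (measurable_splice m) (.pi (Finset.countable_toSet _) fun i _ => ht i)]
  have : (fun p : (ℕ → α) × (ℕ → α) => splice m p.1 p.2) ⁻¹'
      (Finset.range (m + N) : Set ℕ).pi t =
      ((Finset.range m : Set ℕ).pi t) ×ˢ ((Finset.range N : Set ℕ).pi fun i => t (m + i)) := by
    ext ⟨c, c'⟩
    simp only [mem_preimage, Set.mem_pi, Finset.coe_range, mem_Iio, mem_prod]
    constructor
    · exact fun H => ⟨fun i hi => by simpa [splice_of_lt hi] using H i (by omega),
        fun i hi => by simpa [splice_add] using H (m + i) (by omega)⟩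
    · rintro ⟨H1, H2⟩ i hi
      by_cases him : i < m
      · simpa [splice_of_lt him] using H1 i him
      · obtain ⟨k, rfl⟩ := Nat.exists_eq_add_of_le (not_lt.1 him)
        simpa [splice_add] using H2 k (by omega)
  rw [this, prod_prod, infinitePi_pi _ fun i _ => ht i,
    infinitePi_pi (fun i => κ (m + i)) (t := fun i => t (m + i)) fun i _ => ht _,
    Finset.prod_range_add]

open Measure in
-- Read off from the case `m = 1` of `splice`: the first entry and the tail of `splice 1 c c'` are
-- `c 0` and `c'`, which are independent.
lemma measurePreserving_uncons (κ : ℕ → Measure α) [∀ i, IsProbabilityMeasure (κ i)] :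
    MeasurePreserving (fun c : ℕ → α => (c 0, fun i => c (1 + i)))
      (infinitePi κ) ((κ 0).prod (infinitePi fun i => κ (1 + i))) := by
  have hm : Measurable (fun c : ℕ → α => (c 0, fun i => c (1 + i))) := by fun_prop
  refine ⟨hm, ?_⟩
  have h := (measurePreserving_splice κ 1).map_eq
  rw [← h, map_map hm (measurable_splice 1)]
  have e : (fun c : ℕ → α => (c 0, fun i => c (1 + i))) ∘
      (fun p : (ℕ → α) × (ℕ → α) => splice 1 p.1 p.2) = Prod.map (fun c => c 0) id := by
    ext p <;> simp [splice_add, splice_of_lt]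
  rw [e, ← map_prod_map _ _ (by fun_prop) measurable_id, infinitePi_map_eval, Measure.map_id]

open Measure in
-- Approximate `A` by a cylinder within `ε / 2`. Splicing beyond the coordinates of the cylinder
-- does not affect membership in it, and both `p.1` and the spliced sequence have law `infinitePi
-- κ`, so each contributes an error of at most `ε / 2`.
lemma tendsto_measure_splice_mem_ne (κ : ℕ → Measure α) [∀ i, IsProbabilityMeasure (κ i)]
    {A : Set (ℕ → α)} (hA : MeasurableSet A) :
    Tendsto (fun m => ((infinitePi κ).prod (infinitePi fun i => κ (m + i)))
      {p | ¬ (p.1 ∈ A ↔ splice m p.1 p.2 ∈ A)}) atTop (𝓝 0) := by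
  rw [ENNReal.tendsto_nhds_zero]
  intro ε hε
  obtain ⟨B, hB, hAB⟩ := exists_measure_symmDiff_lt_of_generateFrom_isSetRing
    (μ := infinitePi κ) (C := measurableCylinders fun _ : ℕ => α) isSetRing_measurableCylinders
    ⟨{univ}, countable_singleton _, singleton_subset_iff.2 (univ_mem_measurableCylinders _), by simp⟩
    generateFrom_measurableCylinders.symm hA (ε := ε / 2) (by simpa using hε.ne')
  obtain ⟨I, S, hS, rfl⟩ := (mem_measurableCylinders _).1 hB
  have hBm : MeasurableSet (cylinder I S) :=
    MeasurableSet.cylinder (α := fun _ : ℕ => α) I hS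
  filter_upwards [eventually_gt_atTop (I.sup id)] with m hm
  have hinv : ∀ c c' : ℕ → α, splice m c c' ∈ cylinder I S ↔ c ∈ cylinder I S := fun c c' => by
    have : I.restrict (splice m c c') = I.restrict c := by
      ext ⟨i, hi⟩
      exact splice_of_lt ((Finset.le_sup (f := id) hi).trans_lt hm) _ _
    simp [mem_cylinder, this]
  have hD : MeasurableSet (symmDiff A (cylinder I S)) := hA.symmDiff hBm
  have hsub : {p : (ℕ → α) × (ℕ → α) | ¬ (p.1 ∈ A ↔ splice m p.1 p.2 ∈ A)} ⊆
      Prod.fst ⁻¹' (symmDiff A (cylinder I S)) ∪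
      (fun p : (ℕ → α) × (ℕ → α) => splice m p.1 p.2) ⁻¹' (symmDiff A (cylinder I S)) := by
    rintro ⟨c, c'⟩ h
    have := hinv c c'
    simp only [mem_ofPred_eq, mem_union, mem_preimage, Set.mem_symmDiff] at h ⊢
    tauto
  refine (measure_mono hsub).trans ((measure_union_le _ _).trans ?_)
  rw [(measurePreserving_fst (μ := infinitePi κ)
      (ν := infinitePi fun i => κ (m + i))).measure_preimage hD.nullMeasurableSet,
    (measurePreserving_splice κ m).measure_preimage hD.nullMeasurableSet]
  calc _ ≤ ε / 2 + ε / 2 := by rw [symmDiff_comm]; gcongr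
    _ = ε := ENNReal.add_halves ε

open Measure in
/-- A measurable function of a random sequence with independent entries, with finitely many values,
is determined with high probability by a long initial segment of the sequence. -/
lemma tendsto_measure_splice_ne (κ : ℕ → Measure α) [∀ i, IsProbabilityMeasure (κ i)]
    {Q : Type*} [Finite Q] [MeasurableSpace Q] [MeasurableSingletonClass Q]
    {θ : (ℕ → α) → Q} (hθ : Measurable θ) :
    Tendsto (fun m => ((infinitePi κ).prod (infinitePi fun i => κ (m + i)))
      {p | θ (splice m p.1 p.2) ≠ θ p.1}) atTop (𝓝 0) := by
  have := Fintype.ofFinite Q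
  have h := tendsto_finsetSum (Finset.univ : Finset Q) fun j _ =>
    tendsto_measure_splice_mem_ne κ (hθ (measurableSet_singleton j))
  rw [Finset.sum_const_zero] at h
  refine tendsto_of_tendsto_of_tendsto_of_le_of_le tendsto_const_nhds h (fun _ => zero_le) fun m => ?_
  refine (measure_mono ?_).trans (measure_biUnion_finset_le _ _)
  intro p hp
  simp only [mem_iUnion, Finset.mem_univ, exists_prop, true_and]
  exact ⟨θ p.1, by simpa using hp⟩

end Splice

/-! ### Representatives of points, injectivity and topology of the inductive limit -/

/-- The map `(f, c 0, c 1, …) ↦ (f * c 0 * ⋯ * c (k-1), c k, c (k+1), …)`. -/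
def advance {M : Type*} [Monoid M] (k : ℕ) (p : M × (ℕ → M)) : M × (ℕ → M) :=
  (p.1 * listProd p.2 0 k, fun i => p.2 (k + i))

lemma listProd_add {M : Type*} [Monoid M] (a : ℕ → M) (j k : ℕ) :
    listProd a 0 (j + k) = listProd a 0 j * listProd (fun i => a (j + i)) 0 k := by
  induction k with
  | zero => simp [listProd_self]
  | succ k ih => rw [← add_assoc, listProd_succ _ (Nat.zero_le _), ih,
      listProd_succ _ (Nat.zero_le _), mul_assoc]

lemma listProd_shift {M : Type*} [Monoid M] (a : ℕ → M) (j k : ℕ) :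
    listProd (fun i => a (j + i)) 0 k = listProd a j (j + k) := by
  induction k with
  | zero => simp [listProd_self]
  | succ k ih => rw [← add_assoc, listProd_succ _ (Nat.zero_le _), ih,
      listProd_succ _ (Nat.le_add_right _ _)]

lemma advance_zero {M : Type*} [Monoid M] (p : M × (ℕ → M)) : advance 0 p = p := by
  simp [advance, listProd_self]

lemma advance_add {M : Type*} [Monoid M] (j k : ℕ) (p : M × (ℕ → M)) :
    advance (j + k) p = advance k (advance j p) := by
  simp only [advance, listProd_add, mul_assoc, add_assoc]

namespace CFSeq

variable {G : Type u} [Group G] (S : CFSeq G)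

lemma val_embed (n : ℕ) (p : S.Level n) : (S.embed n p).1 = advance 1 p.1 := by
  simp only [embed, advance, listProd_succ _ (le_refl 0), listProd_self, one_mul]
  simp only [add_comm 1]

lemma advance_mem_levelSet {n : ℕ} {p : G × (ℕ → G)} (hp : p ∈ S.levelSet n) (k : ℕ) :
    advance k p ∈ S.levelSet (n + k) := by
  refine ⟨?_, fun i => by simpa only [add_assoc] using! hp.2 (k + i)⟩
  exact S.mul_Cprod_subset (Nat.le_add_right n k)
    (Set.mul_mem_mul hp.1 (S.listProd_mem_Cprod n p.2 hp.2 (Nat.zero_le k)))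

lemma incl_advance {n : ℕ} (p : S.Level n) (k : ℕ) :
    S.incl (n + k) ⟨advance k p.1, S.advance_mem_levelSet p.2 k⟩ = S.incl n p := by
  induction k with
  | zero =>
    congr 1
    exact Subtype.ext (advance_zero _)
  | succ k ih =>
    rw [← ih, ← S.incl_embed (n + k)]
    have e : (⟨_, S.advance_mem_levelSet p.2 (k + 1)⟩ : S.Level (n + k + 1)) =
        S.embed (n + k) ⟨_, S.advance_mem_levelSet p.2 k⟩ :=
      Subtype.ext (by rw [val_embed, ← advance_add])
    exact congrArg (S.incl (n + k + 1)) e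

lemma exists_incl (x : S.Space) : ∃ n, ∃ p : S.Level n, S.incl n p = x := by
  induction x using Quot.ind with
  | mk a => exact ⟨a.1, a.2, rfl⟩

/-- The tails of the coordinate expansions of a point of `X`. -/
def tailGerm (x : S.Space) : Germ (atTop : Filter ℕ) (G × (ℕ → G)) :=
  Quot.lift (fun a : Σ n, S.Level n =>
      ((fun k => advance (k - a.1) a.2.1 : ℕ → G × (ℕ → G)) : Germ atTop (G × (ℕ → G))))
    (by
      rintro ⟨n, p⟩ _ rfl
      refine Germ.coe_eq.2 ?_
      filter_upwards [eventually_ge_atTop (n + 1)] with k hk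
      rw [val_embed, ← advance_add]
      congr 1
      omega) x

/-- The germ of tails is unchanged by the generating relation, so it descends to the quotient, and
the generated equivalence relation need not be analysed. The truncated subtractions are harmless
since only large `k` matter. -/
lemma eventually_advance_eq {n m : ℕ} {p : S.Level n} {q : S.Level m}
    (h : S.incl n p = S.incl m q) : ∀ᶠ k in atTop, advance (k - n) p.1 = advance (k - m) q.1 :=
  Germ.coe_eq.1 (congrArg S.tailGerm h)

lemma mul_inj {n : ℕ} {f f' c c' : G} (hf : f ∈ S.F n) (hf' : f' ∈ S.F n) (hc : c ∈ S.C n)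
    (hc' : c' ∈ S.C n) (h : f * c = f' * c') : f = f' ∧ c = c' := by
  have hcc : c = c' := by
    by_contra hne
    refine Set.disjoint_left.1 (S.disjoint n c hc c' hc' hne)
      (Set.mul_mem_mul hf (mem_singleton c)) ?_
    rw [h]
    exact Set.mul_mem_mul hf' (mem_singleton c')
  subst hcc
  exact ⟨mul_right_cancel h, rfl⟩

open Classical in
/-- The decomposition of an element of `F n * C n`. -/
noncomputable def split (n : ℕ) (g : G) : S.F n × S.C n :=
  if h : ∃ q : S.F n × S.C n, (q.1 : G) * q.2 = g then h.choose
  else (⟨1, S.one_mem_F n⟩, ⟨1, S.one_mem_C n⟩)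

lemma split_mul (n : ℕ) (f : S.F n) (c : S.C n) : S.split n (f * c) = (f, c) := by
  have h : ∃ q : S.F n × S.C n, (q.1 : G) * q.2 = f * c := ⟨(f, c), rfl⟩
  have h1 := S.mul_inj h.choose.1.2 f.2 h.choose.2.2 c.2 h.choose_spec
  rw [split, dif_pos h]
  exact Prod.ext (Subtype.ext h1.1) (Subtype.ext h1.2)

/-- A left inverse of `embed`. -/
noncomputable def unembed (n : ℕ) (p : S.Level (n + 1)) : S.Level n :=
  ⟨((S.split n p.1.1).1, fun i => Nat.casesOn i ((S.split n p.1.1).2 : G) fun j => p.1.2 j),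
    (S.split n p.1.1).1.2, fun i => by
      cases i with
      | zero => exact (S.split n p.1.1).2.2
      | succ i => simpa only [add_assoc, add_comm 1] using p.2.2 i⟩

lemma unembed_embed (n : ℕ) : Function.LeftInverse (S.unembed n) (S.embed n) := by
  rintro ⟨⟨f, c⟩, hp⟩
  have h := S.split_mul n ⟨f, hp.1⟩ ⟨c 0, hp.2 0⟩
  refine Subtype.ext (Prod.ext ?_ (funext fun i => ?_))
  · exact congrArg (fun q => (q.1 : G)) h
  · cases i with
    | zero => exact congrArg (fun q => (q.2 : G)) h
    | succ i => rfl

lemma range_embed (n : ℕ) :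
    range (S.embed n) = {p : S.Level (n + 1) | p.1.1 ∈ S.F n * S.C n} := by
  ext p
  constructor
  · rintro ⟨q, rfl⟩
    exact Set.mul_mem_mul q.2.1 (q.2.2 0)
  · rintro ⟨f, hf, c, hc, e⟩
    refine ⟨S.unembed n p, Subtype.ext (Prod.ext ?_ rfl)⟩
    have h := S.split_mul n ⟨f, hf⟩ ⟨c, hc⟩
    change ((S.split n p.1.1).1 : G) * ((S.split n p.1.1).2 : G) = p.1.1
    rw [← e]
    change ((S.split n (f * c)).1 : G) * ((S.split n (f * c)).2 : G) = f * c
    rw [h]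

lemma advance_injOn (n k : ℕ) : InjOn (advance k) (S.levelSet n) := by
  induction k with
  | zero => exact fun p _ q _ h => by simpa [advance_zero] using h
  | succ k ih =>
    intro p hp q hq h
    rw [advance_add, advance_add] at h
    refine ih hp hq ?_
    have := (S.unembed_embed (n + k)).injective
      (a₁ := ⟨_, S.advance_mem_levelSet hp k⟩) (a₂ := ⟨_, S.advance_mem_levelSet hq k⟩)
      (Subtype.ext (by simpa only [val_embed] using h))
    exact congrArg Subtype.val this

lemma incl_injective (n : ℕ) : Function.Injective (S.incl n) := fun p q h => by
  obtain ⟨k, hk⟩ := (S.eventually_advance_eq h).exists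
  exact Subtype.ext (S.advance_injOn n _ p.2 q.2 hk)

lemma incl_preimage_succ (n : ℕ) {A : Set S.Space} (hA : A ⊆ range (S.incl n)) :
    S.incl (n + 1) ⁻¹' A = S.embed n '' (S.incl n ⁻¹' A) := by
  ext p
  constructor
  · intro hp
    obtain ⟨q, hq⟩ := hA hp
    have hqp : S.embed n q = p := S.incl_injective _ ((S.incl_embed n q).trans hq)
    exact ⟨q, by rw [mem_preimage, hq]; exact hp, hqp⟩
  · rintro ⟨q, hq, rfl⟩
    rw [mem_preimage, incl_embed]
    exact hq

/-! ### Topology of the space -/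

variable [TopologicalSpace G]

lemma isOpen_iff {A : Set S.Space} : IsOpen A ↔ ∀ n, IsOpen (S.incl n ⁻¹' A) := by
  change IsOpen (Quot.mk _ ⁻¹' A) ↔ _
  exact isOpen_sigma_iff

lemma continuous_incl (n : ℕ) : Continuous (S.incl n) :=
  ⟨fun _ hA => S.isOpen_iff.1 hA n⟩

variable [DiscreteTopology G]

/-- As `G` is discrete, `split` is continuous, so `unembed` is a continuous left inverse; the range
is open because it is a condition on the first coordinate alone. -/
lemma isOpenEmbedding_embed (n : ℕ) : IsOpenEmbedding (S.embed n) := by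
  have h1 : Continuous (S.embed n) := by
    unfold embed
    fun_prop
  have h2 : Continuous (S.unembed n) := by
    have hs : Continuous (S.split n) := continuous_of_discreteTopology
    have hi : Continuous fun p : S.Level (n + 1) => S.split n p.1.1 := by fun_prop
    refine Continuous.subtype_mk (Continuous.prodMk (by fun_prop) (continuous_pi fun i => ?_)) _
    cases i with
    | zero => dsimp only; fun_prop
    | succ i => dsimp only; fun_prop
  refine ⟨(S.unembed_embed n).isEmbedding h2 h1, ?_⟩
  rw [range_embed]
  exact (isOpen_discrete (S.F n * S.C n)).preimage (by fun_prop : Continuous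
    fun p : S.Level (n + 1) => p.1.1)

/-- Openness in the limit is tested on every level: above `n` the set is pushed forward along the
open maps `embed`, below `n` it is pulled back along continuous ones. -/
lemma isOpenEmbedding_incl (n : ℕ) : IsOpenEmbedding (S.incl n) := by
  refine .of_continuous_injective_isOpenMap (S.continuous_incl n) (S.incl_injective n) fun U hU => ?_
  rw [isOpen_iff]
  have hup : ∀ m, n ≤ m → IsOpen (S.incl m ⁻¹' (S.incl n '' U)) := by
    intro m hm
    induction m, hm using Nat.le_induction with
    | base => rwa [preimage_image_eq _ (S.incl_injective n)]
    | succ m hm ih =>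
      rw [S.incl_preimage_succ m ((image_subset_range _ _).trans (S.range_incl_mono hm))]
      exact (S.isOpenEmbedding_embed m).isOpenMap _ ih
  intro m
  rcases le_total n m with h | h
  · exact hup m h
  · induction h using Nat.decreasingInduction with
    | self => exact hup n le_rfl
    | of_succ m hm ih =>
      have : S.incl m ⁻¹' (S.incl n '' U) = S.embed m ⁻¹' (S.incl (m + 1) ⁻¹' (S.incl n '' U)) := by
        ext p
        simp only [mem_preimage, incl_embed]
      rw [this]
      exact ih.preimage (S.isOpenEmbedding_embed m).continuous

end CFSeq

/-! ### Convolution products and the product measures on the levels -/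

section Conv

variable {G : Type u} [Group G] [MeasurableSpace G]

lemma convProd_self (κ : ℕ → Measure G) (n : ℕ) : convProd κ n n = Measure.dirac 1 := by
  simp [convProd]

lemma convProd_succ (κ : ℕ → Measure G) {n m : ℕ} (h : n ≤ m) :
    convProd κ n (m + 1) = (convProd κ n m).mconv (κ m) := by
  simp [convProd, List.Ico.succ_top h]

variable [Countable G] [DiscreteMeasurableSpace G]

lemma isProbabilityMeasure_convProd (κ : ℕ → Measure G) [∀ i, IsProbabilityMeasure (κ i)]
    {n m : ℕ} (h : n ≤ m) : IsProbabilityMeasure (convProd κ n m) := by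
  induction m, h using Nat.le_induction with
  | base => rw [convProd_self]; infer_instance
  | succ m h ih => rw [convProd_succ κ h]; infer_instance

lemma measurable_listProd (n m : ℕ) : Measurable fun c : ℕ → G => listProd c n m := by
  unfold listProd
  induction List.Ico n m with
  | nil => simp
  | cons a l ih => simpa only [List.map_cons, List.prod_cons] using! (measurable_pi_apply a).mul ih

lemma measurable_advance (k : ℕ) : Measurable (advance k : G × (ℕ → G) → G × (ℕ → G)) := by
  have h : Measurable fun p : G × (ℕ → G) => listProd p.2 0 k :=
    (measurable_listProd 0 k).comp measurable_snd
  exact (measurable_fst.mul h).prodMk (by fun_prop)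

end Conv

namespace CFData

variable {G : Type u} [Group G] [MeasurableSpace G] (D : CFData G)

/-- The measure `κ_{n+1} ⊗ κ_{n+2} ⊗ ⋯`. -/
noncomputable def seqMeasure (n : ℕ) : Measure (ℕ → G) := Measure.infinitePi fun i => D.κ (n + i)

/-- The measure `ν_n ⊗ κ_{n+1} ⊗ κ_{n+2} ⊗ ⋯` on all pairs `(f, c)`. -/
noncomputable def prodMeasure (n : ℕ) : Measure (G × (ℕ → G)) := (D.ν n).prod (D.seqMeasure n)

variable {D}

lemma Admissible.isProbabilityMeasure_seqMeasure (hD : D.Admissible) (n : ℕ) :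
    IsProbabilityMeasure (D.seqMeasure n) := by
  have := hD.prob_κ
  unfold seqMeasure
  infer_instance

lemma Admissible.ae_mem_C (hD : D.Admissible) (n : ℕ) : ∀ᵐ c ∂D.seqMeasure n, ∀ i, c i ∈ D.C (n + i) := by
  have := hD.prob_κ
  rw [ae_all_iff]
  intro i
  have h : ∀ᵐ a ∂D.κ (n + i), a ∈ D.C (n + i) := hD.supp_κ (n + i)
  rw [← Measure.infinitePi_map_eval (fun i => D.κ (n + i)) i] at h
  exact ae_of_ae_map (measurable_pi_apply i).aemeasurable h

lemma Admissible.ae_mem_levelSet (hD : D.Admissible) (n : ℕ) : ∀ᵐ p ∂D.prodMeasure n, p ∈ D.levelSet n := by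
  have := hD.isProbabilityMeasure_seqMeasure
  have := hD.fin_ν
  have h1 : ∀ᵐ f ∂D.ν n, f ∈ D.F n := hD.supp_ν n
  filter_upwards [Measure.quasiMeasurePreserving_fst.ae h1,
    Measure.quasiMeasurePreserving_snd.ae (hD.ae_mem_C n)] with p h1 h2 using ⟨h1, h2⟩

lemma Admissible.ae_prodMeasure_snd (hD : D.Admissible) {n : ℕ} {P : (ℕ → G) → Prop}
    (h : ∀ᵐ c ∂D.seqMeasure n, P c) : ∀ᵐ p ∂D.prodMeasure n, P p.2 := by
  have := hD.isProbabilityMeasure_seqMeasure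
  exact Measure.quasiMeasurePreserving_snd.ae h

/-- Each `f ∈ F n` is an atom of `ν n`, so the slice of a null set over `f` must be null. -/
lemma Admissible.ae_seqMeasure_of_ae (hD : D.Admissible) {n : ℕ} {P : G × (ℕ → G) → Prop}
    (h : ∀ᵐ p ∂D.prodMeasure n, P p) {f : G} (hf : f ∈ D.F n) :
    ∀ᵐ c ∂D.seqMeasure n, P (f, c) := by
  have := hD.isProbabilityMeasure_seqMeasure
  have h1 := Measure.ae_ae_of_ae_prod h
  by_contra hc
  exact (hD.pos_ν n f hf).ne' (measure_mono_null (singleton_subset_iff.2 hc) h1)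

lemma Admissible.ν_restrict_F (hD : D.Admissible) (n : ℕ) : (D.ν n).restrict (D.F n) = D.ν n :=
  Measure.restrict_eq_self_of_ae_mem (hD.supp_ν n)

variable [Countable G] [DiscreteMeasurableSpace G]

/-- The measure `ρ` is left general so that the step can be iterated, and so that both `ρ = ν n` and
`ρ = δ_1` can be inserted. -/
lemma Admissible.map_advance_one (hD : D.Admissible) (ρ : Measure G) [SFinite ρ] (n : ℕ) :
    (ρ.prod (D.seqMeasure n)).map (advance 1) =
      (ρ.mconv (D.κ n)).prod (D.seqMeasure (n + 1)) := by
  have hκ := hD.prob_κ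
  have := hD.isProbabilityMeasure_seqMeasure
  have h1 : MeasurePreserving (fun c : ℕ → G => (c 0, fun i => c (1 + i)))
      (D.seqMeasure n) ((D.κ n).prod (D.seqMeasure (n + 1))) := by
    simpa only [seqMeasure, add_assoc, add_zero] using measurePreserving_uncons fun i => D.κ (n + i)
  have h2 := ((MeasurePreserving.id ρ).prod h1).map_eq
  have h3 := ((measurePreserving_prodAssoc ρ (D.κ n) (D.seqMeasure (n + 1))).symm _).map_eq
  have h4 : (advance 1 : G × (ℕ → G) → _) =
      Prod.map (fun q : G × G => q.1 * q.2) id ∘ (MeasurableEquiv.prodAssoc.symm ∘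
        Prod.map id (fun c : ℕ → G => (c 0, fun i => c (1 + i)))) := by
    ext p : 1
    simp [advance, listProd, MeasurableEquiv.prodAssoc, Equiv.prodAssoc]
  rw [h4, ← Measure.map_map (by fun_prop) (by fun_prop), ← Measure.map_map (by fun_prop)
    (by fun_prop), h2, h3, ← Measure.map_prod_map _ _ (by fun_prop) measurable_id, Measure.map_id,
    Measure.mconv]

lemma Admissible.map_advance (hD : D.Admissible) (ρ : Measure G) [SFinite ρ] (n k : ℕ) :
    (ρ.prod (D.seqMeasure n)).map (advance k) =
      (ρ.mconv (D.κprod n (n + k))).prod (D.seqMeasure (n + k)) := by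
  have := hD.prob_κ
  induction k with
  | zero =>
    have : (advance 0 : G × (ℕ → G) → _) = id := funext advance_zero
    rw [this, Measure.map_id, add_zero, κprod, convProd_self, Measure.mconv_dirac_one]
  | succ k ih =>
    have e : (advance (k + 1) : G × (ℕ → G) → _) = advance 1 ∘ advance k := funext (advance_add k 1)
    have := isProbabilityMeasure_convProd D.κ (Nat.le_add_right n k)
    rw [e, ← Measure.map_map (measurable_advance 1) (measurable_advance k), ih]
    rw [κprod, hD.map_advance_one, Measure.mconv_assoc, ← convProd_succ _ (Nat.le_add_right n k)]
    rfl

/-- This is `map_advance` for `ρ = δ_1`: a partial product has the convolution as its law and is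
independent of the remaining tail. -/
lemma Admissible.measurePreserving_listProd_shift (hD : D.Admissible) (n k : ℕ) :
    MeasurePreserving (fun c : ℕ → G => (listProd c 0 k, fun i => c (k + i)))
      (D.seqMeasure n) ((D.κprod n (n + k)).prod (D.seqMeasure (n + k))) := by
  have := hD.prob_κ
  have := hD.isProbabilityMeasure_seqMeasure
  have := isProbabilityMeasure_convProd D.κ (Nat.le_add_right n k)
  have h := hD.map_advance (Measure.dirac 1) n k
  rw [κprod, Measure.dirac_one_mconv, Measure.dirac_prod, Measure.map_map (measurable_advance k)
    (by fun_prop)] at h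
  have e : (advance k : G × (ℕ → G) → _) ∘ Prod.mk 1 =
      fun c : ℕ → G => (listProd c 0 k, fun i => c (k + i)) := by
    ext c : 1
    simp [advance]
  rw [e] at h
  exact ⟨(measurable_listProd 0 k).prodMk (by fun_prop), h⟩

lemma Admissible.measurePreserving_shift (hD : D.Admissible) (n k : ℕ) :
    MeasurePreserving (fun (c : ℕ → G) i => c (k + i)) (D.seqMeasure n) (D.seqMeasure (n + k)) := by
  have := hD.prob_κ
  have := hD.isProbabilityMeasure_seqMeasure
  have : IsProbabilityMeasure (D.κprod n (n + k)) :=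
    isProbabilityMeasure_convProd D.κ (Nat.le_add_right n k)
  exact measurePreserving_snd.comp (hD.measurePreserving_listProd_shift n k)

lemma Admissible.measurePreserving_listProd (hD : D.Admissible) (n k : ℕ) :
    MeasurePreserving (fun c : ℕ → G => listProd c 0 k) (D.seqMeasure n) (D.κprod n (n + k)) := by
  have := hD.isProbabilityMeasure_seqMeasure
  exact measurePreserving_fst.comp (hD.measurePreserving_listProd_shift n k)

lemma Admissible.measurePreserving_listProd_add (hD : D.Admissible) (n j k : ℕ) :
    MeasurePreserving (fun c : ℕ → G => listProd c j (j + k)) (D.seqMeasure n)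
      (D.κprod (n + j) (n + j + k)) := by
  simpa only [Function.comp_def, listProd_shift] using
    (hD.measurePreserving_listProd (n + j) k).comp (hD.measurePreserving_shift n j)

/-- Multiplication is injective on `F n × C n`, so the convolution has mass `ν_n(f) κ_n(c)` at `f *
c`, which is `ν_{n+1}(f * c)`. -/
lemma Admissible.restrict_mconv (hD : D.Admissible) {n : ℕ} {A : Set G} (hA : A ⊆ D.F n) :
    ((D.ν n).restrict A).mconv (D.κ n) = (D.ν (n + 1)).restrict (A * D.C n) := by
  have := hD.prob_κ
  have := hD.fin_ν
  refine Measure.ext_of_singleton fun x => ?_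
  rw [Measure.mconv, Measure.map_apply measurable_mul (measurableSet_singleton x),
    Measure.restrict_apply (measurableSet_singleton x)]
  have hae : ∀ᵐ q ∂((D.ν n).restrict A).prod (D.κ n), q.1 ∈ A ∧ q.2 ∈ D.C n := by
    have h1 : ∀ᵐ f ∂(D.ν n).restrict A, f ∈ A := ae_restrict_mem (.of_discrete)
    have h2 : ∀ᵐ c ∂D.κ n, c ∈ D.C n := hD.supp_κ n
    filter_upwards [Measure.quasiMeasurePreserving_fst.ae h1,
      Measure.quasiMeasurePreserving_snd.ae h2] with q h1 h2 using ⟨h1, h2⟩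
  by_cases hx : x ∈ A * D.C n
  · obtain ⟨f, hf, c, hc, rfl⟩ := hx
    have e : (fun q : G × G => q.1 * q.2) ⁻¹' {f * c} =ᵐ[((D.ν n).restrict A).prod (D.κ n)]
        ({f} ×ˢ {c} : Set (G × G)) := by
      filter_upwards [hae] with q hq
      refine propext ⟨fun h => ?_, fun h => ?_⟩
      · obtain ⟨h1, h2⟩ := D.mul_inj (hA hq.1) (hA hf) hq.2 hc h
        exact ⟨h1, h2⟩
      · obtain ⟨h1, h2⟩ := h
        exact congrArg₂ (· * ·) h1 h2
    rw [measure_congr e, Measure.prod_prod, Measure.restrict_apply (measurableSet_singleton f),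
      inter_eq_left.2 (singleton_subset_iff.2 hf),
      inter_eq_left.2 (singleton_subset_iff.2 (Set.mul_mem_mul hf hc)), hD.ν_mul n f (hA hf) c hc]
  · rw [singleton_inter_eq_empty.2 hx, measure_empty]
    refine measure_mono_null (fun q hq => ?_) hae
    rintro ⟨h1, h2⟩
    exact hx (hq ▸ Set.mul_mem_mul h1 h2)

lemma Admissible.ν_mconv (hD : D.Admissible) (n k : ℕ) :
    (D.ν n).mconv (D.κprod n (n + k)) =
      (D.ν (n + k)).restrict (D.F n * D.Cprod n (n + k)) := by
  have := hD.prob_κ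
  have := hD.fin_ν
  induction k with
  | zero => rw [add_zero, κprod, convProd_self, Measure.mconv_dirac_one, CFSeq.Cprod_self,
      singleton_one, mul_one, hD.ν_restrict_F]
  | succ k ih =>
    have := isProbabilityMeasure_convProd D.κ (Nat.le_add_right n k)
    have e := convProd_succ D.κ (Nat.le_add_right n k)
    rw [κprod] at ih ⊢
    rw [← add_assoc, e, ← Measure.mconv_assoc, ih,
      hD.restrict_mconv (D.mul_Cprod_subset (Nat.le_add_right n k)),
      D.Cprod_succ (Nat.le_add_right n k), mul_assoc]

lemma Admissible.map_advance_prodMeasure (hD : D.Admissible) (n k : ℕ) :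
    (D.prodMeasure n).map (advance k) =
      ((D.ν (n + k)).restrict (D.F n * D.Cprod n (n + k))).prod (D.seqMeasure (n + k)) := by
  have := hD.fin_ν
  rw [prodMeasure, hD.map_advance, hD.ν_mconv]

end CFData

/-! ### The action and the measure on the inductive limit -/

namespace CFSeq

variable {G : Type u} [Group G] (S : CFSeq G)

lemma incl_congr {n m : ℕ} (h : n = m) {p q : G × (ℕ → G)} (hp : p ∈ S.levelSet n)
    (hq : q ∈ S.levelSet m) (hpq : p = q) : S.incl n ⟨p, hp⟩ = S.incl m ⟨q, hq⟩ := by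
  subst h hpq
  rfl

lemma incl_eq_of_advance_eq {n m k : ℕ} (hn : n ≤ k) (hm : m ≤ k) {p : S.Level n} {q : S.Level m}
    (h : advance (k - n) p.1 = advance (k - m) q.1) : S.incl n p = S.incl m q := by
  rw [← S.incl_advance p (k - n), ← S.incl_advance q (k - m)]
  exact S.incl_congr (by omega) _ _ h

lemma advance_mul_left (g : G) (k : ℕ) (p : G × (ℕ → G)) :
    advance k (g * p.1, p.2) = (g * (advance k p).1, (advance k p).2) := by
  simp [advance, mul_assoc]

/-- The representative chosen in `act` may differ from `p`, but the two agree after advancing far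
enough, and `advance` commutes with left multiplication of the first coordinate. -/
lemma act_incl (g : G) {n : ℕ} (p : S.Level n) (hp : S.incl n p ∈ S.fullDomain)
    (hg : g * p.1.1 ∈ S.F n) :
    S.act g (S.incl n p) = S.incl n ⟨(g * p.1.1, p.1.2), hg, p.2.2⟩ := by
  rw [act, dif_pos hp]
  have h' := mem_iInter.1 hp g
  have e := h'.choose_spec.choose_spec.1
  obtain ⟨k, h1, hk⟩ := ((S.eventually_advance_eq e).and
    ((eventually_ge_atTop n).and (eventually_ge_atTop h'.choose))).exists
  refine (S.incl_eq_of_advance_eq hk.1 hk.2 ?_).symm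
  have h2 := advance_mul_left g (k - n) p.1
  have h3 := advance_mul_left g (k - h'.choose) h'.choose_spec.choose.1
  rw [← h1] at h3
  exact h2.trans h3.symm

lemma measurableSet_levelSet [MeasurableSpace G] [DiscreteMeasurableSpace G] (n : ℕ) :
    MeasurableSet (S.levelSet n) := by
  have e : S.levelSet n = Prod.fst ⁻¹' S.F n ∩
      ⋂ i, (fun p : G × (ℕ → G) => p.2 i) ⁻¹' S.C (n + i) := by
    ext p
    simp [levelSet]
  rw [e]
  exact (measurable_fst .of_discrete).inter (.iInter fun i =>
    (by fun_prop : Measurable fun p : G × (ℕ → G) => p.2 i) .of_discrete)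

end CFSeq

namespace CFData

variable {G : Type u} [Group G] [Countable G] [TopologicalSpace G] [DiscreteTopology G]
  [MeasurableSpace G] [BorelSpace G] {D : CFData G}

lemma measurableEmbedding_embed (S : CFSeq G) (n : ℕ) : MeasurableEmbedding (S.embed n) :=
  (S.isOpenEmbedding_embed n).measurableEmbedding

lemma measurableEmbedding_incl (S : CFSeq G) (n : ℕ) : MeasurableEmbedding (S.incl n) :=
  (S.isOpenEmbedding_incl n).measurableEmbedding

lemma Admissible.map_val_levelMeasure (hD : D.Admissible) (n : ℕ) :
    (D.levelMeasure n).map Subtype.val = D.prodMeasure n := by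
  refine ((MeasurableEmbedding.subtype_coe (D.measurableSet_levelSet n)).map_comap _).trans ?_
  rw [Subtype.range_coe]
  exact Measure.restrict_eq_self_of_ae_mem (hD.ae_mem_levelSet n)

/-- Consistency of the level measures: it is the identity for `advance 1` on pairs, read on the
subtypes. -/
lemma Admissible.map_embed_levelMeasure (hD : D.Admissible) (n : ℕ) :
    (D.levelMeasure n).map (D.embed n) =
      (D.levelMeasure (n + 1)).restrict (range (D.embed n)) := by
  have := hD.isProbabilityMeasure_seqMeasure
  have := hD.fin_ν
  have hv := fun k => MeasurableEmbedding.subtype_coe (D.measurableSet_levelSet k)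
  refine (hv (n + 1)).map_injective ?_
  have e : (Subtype.val ∘ D.embed n) = advance 1 ∘ Subtype.val := funext fun p => D.val_embed n p
  rw [Measure.map_map (hv _).measurable (measurableEmbedding_embed _ n).measurable, e,
    ← Measure.map_map (measurable_advance 1) (hv _).measurable, hD.map_val_levelMeasure,
    hD.map_advance_prodMeasure, D.Cprod_succ le_rfl, D.Cprod_self, singleton_one, one_mul]
  have e2 : range (D.embed n) =
      (Subtype.val : D.Level (n + 1) → _) ⁻¹' ((D.F n * D.C n) ×ˢ univ) := by
    rw [D.range_embed]
    ext p
    simp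
  rw [e2, ← (hv _).restrict_map, hD.map_val_levelMeasure, prodMeasure, ← Measure.prod_restrict,
    Measure.restrict_univ]

lemma Admissible.map_incl_levelMeasure (hD : D.Admissible) {n m : ℕ} (h : n ≤ m) :
    (D.levelMeasure n).map (D.incl n) =
      ((D.levelMeasure m).map (D.incl m)).restrict (range (D.incl n)) := by
  have hi := fun k => measurableEmbedding_incl D.toCFSeq k
  induction m, h using Nat.le_induction with
  | base =>
    rw [(hi n).restrict_map, preimage_range, Measure.restrict_univ]
  | succ m h ih =>
    have e : (D.levelMeasure m).map (D.incl m) =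
        ((D.levelMeasure (m + 1)).map (D.incl (m + 1))).restrict (range (D.incl m)) := by
      have e1 : D.incl m = D.incl (m + 1) ∘ D.embed m := funext fun p => (D.incl_embed m p).symm
      rw [(hi (m + 1)).restrict_map, D.incl_preimage_succ m subset_rfl, preimage_range, image_univ,
        ← hD.map_embed_levelMeasure, Measure.map_map (hi (m + 1)).measurable
          (measurableEmbedding_embed _ m).measurable, ← e1]
    rw [ih, e, Measure.restrict_restrict (hi n).measurableSet_range,
      inter_eq_left.2 (D.range_incl_mono h)]

lemma Admissible.ae_map_incl_iff (hD : D.Admissible) (n : ℕ) {P : D.Space → Prop} :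
    (∀ᵐ x ∂(D.levelMeasure n).map (D.incl n), P x) ↔
      ∀ᵐ p ∂D.prodMeasure n, ∀ h : p ∈ D.levelSet n, P (D.incl n ⟨p, h⟩) := by
  rw [(measurableEmbedding_incl D.toCFSeq n).ae_map_iff, ← hD.map_val_levelMeasure,
    (MeasurableEmbedding.subtype_coe (D.measurableSet_levelSet n)).ae_map_iff]
  exact eventually_congr (Eventually.of_forall fun p => ⟨fun h _ => h, fun h => h p.2⟩)

/-- A property holds almost everywhere in `X` if and only if it holds almost everywhere in each of
the sets `X_n`. -/
lemma Admissible.ae_μ_iff (hD : D.Admissible) {P : D.Space → Prop} :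
    (∀ᵐ x ∂D.μ, P x) ↔
      ∀ n, ∀ᵐ p ∂D.prodMeasure n, ∀ h : p ∈ D.levelSet n, P (D.incl n ⟨p, h⟩) := by
  simp only [← hD.ae_map_incl_iff]
  have hr := fun k => (measurableEmbedding_incl D.toCFSeq k).measurableSet_range
  have hd := fun k => MeasurableSet.disjointed hr k
  rw [μ, Measure.ae_sum_iff]
  refine ⟨fun h n => ?_, fun h n => ae_restrict_of_ae (h n)⟩
  -- On the `k`-th disjoint piece, which lies in `X_k`, the images of the level measures `k` and `n`
  -- coincide; the pieces with `k ≤ n` cover `X_n`.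
  have h1 : ∀ k ≤ n, ∀ᵐ x ∂(D.levelMeasure n).map (D.incl n),
      x ∈ disjointed (fun k => range (D.incl k)) k → P x := by
    intro k hk
    rw [← ae_restrict_iff' (hd k)]
    have h2 := h k
    rwa [hD.map_incl_levelMeasure hk, Measure.restrict_restrict (hd k),
      inter_eq_left.2 (disjointed_subset _ k)] at h2
  have h2 : ∀ᵐ x ∂(D.levelMeasure n).map (D.incl n), ∀ k ≤ n,
      x ∈ disjointed (fun k => range (D.incl k)) k → P x := by
    rw [ae_all_iff]
    exact fun k => by
      by_cases hk : k ≤ n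
      · filter_upwards [h1 k hk] with x hx _ using hx
      · exact Eventually.of_forall fun x hk' => absurd hk' hk
  have h3 : ∀ᵐ x ∂(D.levelMeasure n).map (D.incl n), x ∈ range (D.incl n) := by
    rw [hD.ae_map_incl_iff]
    exact Eventually.of_forall fun p hp => mem_range_self _
  filter_upwards [h2, h3] with x hx hxn
  have hU := le_partialSups (fun k => range (D.incl k)) n hxn
  rw [← biUnion_range_succ_disjointed] at hU
  simp only [mem_iUnion, Finset.mem_range, Nat.lt_succ_iff] at hU
  obtain ⟨k, hk, hxk⟩ := hU
  exact hx k hk hxk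

/-- The complement of `X^G` is a null set. -/
lemma Admissible.ae_mem_fullDomain (hD : D.Admissible) : ∀ᵐ x ∂D.μ, x ∈ D.fullDomain := by
  have := hD.isProbabilityMeasure_seqMeasure
  have := hD.fin_ν
  rw [hD.ae_μ_iff]
  intro n
  simp only [CFSeq.fullDomain, mem_iInter]
  suffices ∀ g, ∀ᵐ p ∂D.prodMeasure n, ∀ h : p ∈ D.levelSet n, D.incl n ⟨p, h⟩ ∈ D.domain g by
    filter_upwards [ae_all_iff.2 this] with p hp h g using hp g h
  intro g
  -- `A k` contains the positions at level `n + k` of points of `X_n`; `B k` consists of the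
  -- positions that `g` keeps inside `F (n + k)`.
  let A : ℕ → Set G := fun k => D.F n * D.Cprod n (n + k)
  let B : ℕ → Set G := fun k => g⁻¹ • D.F (n + k)
  have hmap : ∀ (k : ℕ) (E : Set G), D.prodMeasure n (advance k ⁻¹' (E ×ˢ univ)) =
      D.ν (n + k) (E ∩ A k) := by
    intro k E
    rw [← Measure.map_apply (measurable_advance k) (MeasurableSet.of_discrete.prod .univ),
      hD.map_advance_prodMeasure, Measure.prod_prod, measure_univ, mul_one,
      Measure.restrict_apply .of_discrete]
  have hA : ∀ k, D.ν (n + k) (A k) = D.ν n (D.F n) := by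
    intro k
    have h := hmap k univ
    rw [univ_inter, univ_prod_univ, preimage_univ, prodMeasure, ← univ_prod_univ,
      Measure.prod_prod, measure_univ (μ := D.seqMeasure n), mul_one] at h
    rw [← h]
    exact (measure_eq_measure_of_null_sdiff (subset_univ _)
      (by rw [← compl_eq_univ_sdiff]; exact hD.supp_ν n)).symm
  have hbad : ∀ k, D.prodMeasure n (advance k ⁻¹' ((B k)ᶜ ×ˢ univ)) =
      D.ν n (D.F n) - D.ν (n + k) (A k ∩ B k) := by
    intro k
    rw [hmap, ← hA k, inter_comm, ← sdiff_eq, ← sdiff_self_inter,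
      measure_sdiff inter_subset_left MeasurableSet.of_discrete.nullMeasurableSet
        (measure_ne_top _ _)]
  have hlim : Tendsto (fun k => D.prodMeasure n (advance k ⁻¹' ((B k)ᶜ ×ˢ univ))) atTop (𝓝 0) := by
    simp only [hbad]
    have h1 : Tendsto (fun k => D.ν (n + k) (A k ∩ B k)) atTop (𝓝 (D.ν n (D.F n))) :=
      (hD.full g n).comp (tendsto_atTop_mono (fun k => Nat.le_add_left k n) tendsto_id)
    have h2 := ENNReal.Tendsto.sub (tendsto_const_nhds (x := D.ν n (D.F n))) h1
      (.inl (measure_ne_top _ _))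
    rwa [tsub_self] at h2
  -- A point outside `X^g` misses `B k` for every `k`, so the exceptional set lies in each of the
  -- sets whose measure tends to `0`.
  refine le_antisymm (ge_of_tendsto' hlim fun k => measure_mono fun p hp => ?_) zero_le
  simp only [mem_compl_iff, mem_ofPred_eq, not_forall] at hp
  obtain ⟨h, hp⟩ := hp
  refine ⟨fun hB => hp ⟨n + k, ⟨advance k p, D.advance_mem_levelSet h k⟩,
    (D.incl_advance ⟨p, h⟩ k).symm, ?_⟩, mem_univ _⟩
  obtain ⟨f, hf, e⟩ := hB
  change g * (advance k p).1 ∈ _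
  rw [← e]
  simpa using hf

end CFData

/-! ### Cosets and limits along telescopings -/

lemma listProd_mul_listProd {M : Type*} [Monoid M] (a : ℕ → M) {j m : ℕ} (h : j ≤ m) :
    listProd a 0 j * listProd a j m = listProd a 0 m := by
  obtain ⟨k, rfl⟩ := Nat.exists_eq_add_of_le h
  rw [listProd_add, listProd_shift]

lemma smul_coset_eq_iff {G : Type*} [Group G] {Γ : Subgroup G} (c g h : G) :
    c • (g : G ⧸ Γ) = (h : G ⧸ Γ) ↔ h⁻¹ * c * g ∈ Γ := by
  rw [eq_comm, MulAction.Quotient.smul_coe, smul_eq_mul, QuotientGroup.eq, mul_assoc]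

/-- The conjugate `g Γ g⁻¹` is the stabiliser of the coset `g Γ`. -/
lemma mem_map_conj_iff {G : Type*} [Group G] {Γ : Subgroup G} (c g : G) :
    c ∈ Γ.map (MulAut.conj g).toMonoidHom ↔ c • (g : G ⧸ Γ) = g := by
  rw [smul_coset_eq_iff, Subgroup.mem_map]
  constructor
  · rintro ⟨x, hx, rfl⟩
    simpa [mul_assoc] using hx
  · exact fun h => ⟨_, h, by simp [mul_assoc]⟩

lemma mem_conj_mul_iff {G : Type*} [Group G] {Γ : Subgroup G} (c g h : G) :
    c ∈ ({g⁻¹} * (Γ : Set G) * {h} : Set G) ↔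
      c • ((h⁻¹ : G) : G ⧸ Γ) = ((g⁻¹ : G) : G ⧸ Γ) := by
  rw [smul_coset_eq_iff, inv_inv]
  simp only [singleton_mul, mul_singleton, mem_image, SetLike.mem_coe, exists_exists_and_eq_and]
  constructor
  · rintro ⟨x, hx, rfl⟩
    simpa [mul_assoc] using hx
  · exact fun H => ⟨_, H, by simp [mul_assoc]⟩

namespace CFSeq

variable {G : Type u} [Group G] (S : CFSeq G)

lemma listProd_telescopeLevel (l : ℕ → ℕ) (hl : IsTelescopingSeq l) (n : ℕ)
    (p : S.Level (l n)) (m : ℕ) :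
    listProd (S.telescopeLevel l hl n p).1.2 0 m = listProd p.1.2 0 (l (n + m) - l n) := by
  induction m with
  | zero => simp [listProd_self]
  | succ m ih =>
    rw [listProd_succ _ (Nat.zero_le m), ih]
    have h2 : l (n + m) ≤ l (n + m + 1) := hl.strictMono.monotone (by omega)
    exact listProd_mul_listProd _ (by omega)

/-- Limits in a discrete space are eventual equalities, and two representatives have the same
advances from some level on. Hence any representative may be used, with `k` counting absolute
levels. -/
lemma isFactorValue_incl_iff [TopologicalSpace G] {Γ : Subgroup G} [DiscreteTopology (G ⧸ Γ)]
    (q : G ⧸ Γ) {n : ℕ} (p : S.Level n) (j : G ⧸ Γ) :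
    S.IsFactorValue q (S.incl n p) j ↔
      ∀ᶠ k in atTop, (p.1.1 * listProd p.1.2 0 (k - n)) • q = j := by
  have key : ∀ (m : ℕ) (r : S.Level m),
      Tendsto (fun k => (r.1.1 * listProd r.1.2 0 k) • q) atTop (𝓝 j) ↔
        ∀ᶠ k in atTop, (r.1.1 * listProd r.1.2 0 (k - m)) • q = j := by
    intro m r
    rw [nhds_discrete, tendsto_pure, eventually_atTop, eventually_atTop]
    constructor
    · rintro ⟨a, ha⟩
      exact ⟨m + a, fun b hb => ha _ (by omega)⟩
    · rintro ⟨a, ha⟩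
      exact ⟨a, fun b hb => by simpa using ha (b + m) (by omega)⟩
  constructor
  · rintro ⟨m, r, e, hr⟩
    filter_upwards [(key m r).1 hr, S.eventually_advance_eq e] with k h1 h2
    rw [← h1]
    exact congrArg (· • q) (congrArg Prod.fst h2)
  · exact fun h => ⟨n, p, rfl, (key n p).2 h⟩

/-- The partial products of the grouped coordinates are those of the original coordinates at the
levels `l k`; the choices made in `iota` do not matter. -/
lemma isFactorValue_iota_incl_iff [TopologicalSpace G] {Γ : Subgroup G} [DiscreteTopology (G ⧸ Γ)]
    (q : G ⧸ Γ) (l : ℕ → ℕ) (hl : IsTelescopingSeq l) {n : ℕ} (p : S.Level n) (j : G ⧸ Γ) :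
    (S.telescope l hl).IsFactorValue q (S.iota l hl (S.incl n p)) j ↔
      ∀ᶠ k in atTop, (p.1.1 * listProd p.1.2 0 (l k - n)) • q = j := by
  classical
  rw [iota, isFactorValue_incl_iff]
  have e := (Nat.find_spec (S.exists_rep l hl (S.incl n p))).choose_spec
  set N := Nat.find (S.exists_rep l hl (S.incl n p))
  set r := (Nat.find_spec (S.exists_rep l hl (S.incl n p))).choose
  refine eventually_congr ?_
  filter_upwards [eventually_ge_atTop N,
    hl.strictMono.tendsto_atTop.eventually (S.eventually_advance_eq e)] with k hk h2
  rw [listProd_telescopeLevel, Nat.add_sub_cancel' hk]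
  change ((advance (l k - l N) r.1).1 • q = j) ↔ ((advance (l k - n) p.1).1 • q = j)
  rw [h2]

lemma factorMap_eq [TopologicalSpace G] {Γ : Subgroup G} [DiscreteTopology (G ⧸ Γ)]
    {q : G ⧸ Γ} {x : S.Space} {j : G ⧸ Γ} (h : S.IsFactorValue q x j) : S.factorMap q x = j := by
  have h' : ∃ j, S.IsFactorValue q x j := ⟨j, h⟩
  rw [factorMap, dif_pos h']
  obtain ⟨n, p, rfl⟩ := S.exists_incl x
  have h1 := h'.choose_spec
  rw [isFactorValue_incl_iff] at h h1
  obtain ⟨k, h2, h3⟩ := (h.and h1).exists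
  exact h3.symm.trans h2

end CFSeq

/-! ### The factor map of a compatible telescoping -/

namespace CFData

variable {G : Type u} [Group G] [Countable G] [TopologicalSpace G] [DiscreteTopology G]
  [MeasurableSpace G] [BorelSpace G] {D : CFData G}

lemma Admissible.isProbabilityMeasure_κprod (hD : D.Admissible) {n m : ℕ} (h : n ≤ m) :
    IsProbabilityMeasure (D.κprod n m) := by
  have := hD.prob_κ
  exact isProbabilityMeasure_convProd D.κ h

lemma Admissible.κprod_sep (hD : D.Admissible) {n m : ℕ} (h : n ≤ m) (P : G → Prop) :
    D.κprod n m {c ∈ D.Cprod n m | P c} = D.κprod n m {c | P c} := by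
  obtain ⟨k, rfl⟩ := Nat.exists_eq_add_of_le h
  have h1 : ∀ᵐ c ∂D.κprod n (n + k), c ∈ D.Cprod n (n + k) := by
    rw [← (hD.measurePreserving_listProd n k).map_eq, ae_map_iff
      (measurable_listProd 0 k).aemeasurable .of_discrete]
    filter_upwards [hD.ae_mem_C n] with c hc
    exact D.listProd_mem_Cprod n c hc (Nat.zero_le k)
  refine measure_congr ?_
  filter_upwards [h1] with c hc
  exact propext (and_iff_right hc)

lemma Admissible.compatibleWith_telescope_iff (hD : D.Admissible) {Γ : Subgroup G} {g : G}
    {l : ℕ → ℕ} {hl : IsTelescopingSeq l} :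
    (D.telescope l hl).CompatibleWith Γ g ↔
      ∑' k, D.κprod (l k) (l (k + 1)) {c | c • (g : G ⧸ Γ) ≠ g} < ∞ := by
  unfold CompatibleWith
  simp only [mem_map_conj_iff]
  have : ∀ k, (D.telescope l hl).κ k {c ∈ (D.telescope l hl).C k | ¬ c • (g : G ⧸ Γ) = g} =
      D.κprod (l k) (l (k + 1)) {c | c • (g : G ⧸ Γ) ≠ g} := fun k =>
    hD.κprod_sep (hl.strictMono k.lt_succ_self).le _
  simp only [this]

variable {Γ : Subgroup G} [Γ.FiniteIndex]

/-- Along a compatible telescoping the limit that defines the factor map exists almost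
everywhere. -/
lemma Admissible.ae_exists_isFactorValue (hD : D.Admissible) {g : G} {l : ℕ → ℕ}
    {hl : IsTelescopingSeq l} (hc : (D.telescope l hl).CompatibleWith Γ g) :
    ∀ᵐ x ∂D.μ, ∃ j, (D.telescope l hl).IsFactorValue (g : G ⧸ Γ) (D.iota l hl x) j := by
  rw [hD.compatibleWith_telescope_iff] at hc
  rw [hD.ae_μ_iff]
  intro n
  -- The bad event for Borel–Cantelli is that the `k`-th block moves `g Γ`. The guard `n ≤ l k`
  -- discards blocks that are not entirely made of coordinates of `X_n`.
  have hs : ∑' k, D.seqMeasure n {c | n ≤ l k ∧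
      listProd c (l k - n) (l (k + 1) - n) • (g : G ⧸ Γ) ≠ g} ≠ ∞ := by
    refine ne_top_of_le_ne_top hc.ne (ENNReal.tsum_le_tsum fun k => ?_)
    by_cases hk : n ≤ l k
    · obtain ⟨a, ha⟩ := Nat.exists_eq_add_of_le hk
      obtain ⟨b, hb⟩ := Nat.exists_eq_add_of_le (hl.strictMono k.lt_succ_self).le
      have e := (hD.measurePreserving_listProd_add n a b).measure_preimage
        (s := {c | c • (g : G ⧸ Γ) ≠ g}) MeasurableSet.of_discrete.nullMeasurableSet
      have e1 : n + a + b - n = a + b := by omega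
      rw [hb, ha, ← e]
      refine measure_mono fun c hc => ?_
      simpa [e1] using! hc.2
    · simp [hk]
  filter_upwards [hD.ae_prodMeasure_snd (ae_eventually_notMem hs)] with p hp h
  obtain ⟨K, hK⟩ := eventually_atTop.1
    (hp.and (hl.strictMono.tendsto_atTop.eventually (eventually_ge_atTop n)))
  refine ⟨(p.1 * listProd p.2 0 (l K - n)) • (g : G ⧸ Γ),
    (D.isFactorValue_iota_incl_iff _ l hl ⟨p, h⟩ _).2 (eventually_atTop.2 ⟨K, fun k hk => ?_⟩)⟩
  induction k, hk using Nat.le_induction with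
  | base => rfl
  | succ k hk ih =>
    obtain ⟨h1, h2⟩ := hK k hk
    have h3 : listProd p.2 (l k - n) (l (k + 1) - n) • (g : G ⧸ Γ) = g := by
      by_contra hne
      exact h1 ⟨h2, hne⟩
    have h4 : l k ≤ l (k + 1) := (hl.strictMono k.lt_succ_self).le
    rw [← ih, ← listProd_mul_listProd p.2 (show l k - n ≤ l (k + 1) - n by omega), ← mul_assoc,
      mul_smul (p.1 * _), h3]

lemma measurable_of_measurable_comp_incl (S : CFSeq G) {Y : Type*}
    [MeasurableSpace Y] {φ : S.Space → Y}
    (h : ∀ n, Measurable fun p : S.Level n => φ (S.incl n p)) : Measurable φ := by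
  intro A hA
  have e : φ ⁻¹' A = ⋃ n, S.incl n '' ((fun p : S.Level n => φ (S.incl n p)) ⁻¹' A) := by
    ext x
    obtain ⟨n, p, rfl⟩ := S.exists_incl x
    simp only [mem_preimage, mem_iUnion, mem_image]
    exact ⟨fun hx => ⟨n, p, hx, rfl⟩, fun ⟨m, r, hr, e⟩ => e ▸ hr⟩
  rw [e]
  exact .iUnion fun n => (measurableEmbedding_incl S n).measurableSet_image.2 (h n hA)

lemma measurable_factorMap_iota (S : CFSeq G) (q : G ⧸ Γ) (l : ℕ → ℕ) (hl : IsTelescopingSeq l) :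
    Measurable fun x => (S.telescope l hl).factorMap q (S.iota l hl x) := by
  refine measurable_of_measurable_comp_incl S fun n => measurable_to_countable' fun j => ?_
  have hE : ∀ i : G ⧸ Γ, MeasurableSet {p : S.Level n |
      ∀ᶠ k in atTop, (p.1.1 * listProd p.1.2 0 (l k - n)) • q = i} := by
    intro i
    have e : {p : S.Level n | ∀ᶠ k in atTop, (p.1.1 * listProd p.1.2 0 (l k - n)) • q = i} =
        ⋃ K, ⋂ k, ⋂ (_ : K ≤ k), {p | (p.1.1 * listProd p.1.2 0 (l k - n)) • q = i} := by
      ext p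
      simp [eventually_atTop]
    rw [e]
    refine .iUnion fun K => .iInter fun k => .iInter fun _ => ?_
    have hm : Measurable fun p : S.Level n => p.1.1 * listProd p.1.2 0 (l k - n) :=
      (measurable_fst.comp (measurable_advance (l k - n))).comp measurable_subtype_coe
    exact hm (.of_discrete (s := {a : G | a • q = i}))
  -- The second set accounts for the default value `q`, taken where no limit exists.
  have e : (fun p : S.Level n => (S.telescope l hl).factorMap q (S.iota l hl (S.incl n p))) ⁻¹' {j} =
      {p | ∀ᶠ k in atTop, (p.1.1 * listProd p.1.2 0 (l k - n)) • q = j} ∪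
      ({p | j = q} ∩ ⋂ i, {p | ∀ᶠ k in atTop, (p.1.1 * listProd p.1.2 0 (l k - n)) • q = i}ᶜ) := by
    ext p
    simp only [mem_preimage, mem_singleton_iff, mem_union, mem_ofPred_eq, mem_inter_iff, mem_iInter,
      mem_compl_iff, ← S.isFactorValue_iota_incl_iff q l hl p]
    constructor
    · intro h
      by_cases hex : ∃ i, (S.telescope l hl).IsFactorValue q (S.iota l hl (S.incl n p)) i
      · obtain ⟨i, hi⟩ := hex
        have := CFSeq.factorMap_eq _ hi
        exact .inl (by rwa [← h, this])
      · rw [CFSeq.factorMap, dif_neg hex] at h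
        exact .inr ⟨h.symm, not_exists.1 hex⟩
    · rintro (h | ⟨rfl, h⟩)
      · exact CFSeq.factorMap_eq _ h
      · rw [CFSeq.factorMap, dif_neg (not_exists.2 h)]
  rw [e]
  exact (hE j).union ((MeasurableSet.const _).inter (.iInter fun i => (hE i).compl))

/-- On the conull set `X^G`, `T_a` multiplies the first coordinate by `a`, which translates all
partial products and hence their limit. -/
lemma Admissible.isFactorMap_factorMap_iota (hD : D.Admissible) {g : G} {l : ℕ → ℕ}
    {hl : IsTelescopingSeq l} (hc : (D.telescope l hl).CompatibleWith Γ g) :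
    D.IsFactorMap fun x => (D.telescope l hl).factorMap (g : G ⧸ Γ) (D.iota l hl x) := by
  refine ⟨measurable_factorMap_iota _ _ _ _, fun a => ?_⟩
  filter_upwards [hD.ae_exists_isFactorValue hc, hD.ae_mem_fullDomain] with x ⟨j, hj⟩ hx
  obtain ⟨n, p, rfl, hp⟩ := mem_iInter.1 hx a
  rw [D.act_incl a p hx hp]
  refine (CFSeq.factorMap_eq _ ?_).trans (congrArg (a • ·) (CFSeq.factorMap_eq _ hj).symm)
  have hj' := (D.isFactorValue_iota_incl_iff _ l hl p j).1 hj
  refine (D.isFactorValue_iota_incl_iff _ l hl _ _).2 ?_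
  filter_upwards [hj'] with k hk
  rw [← hk, smul_smul, mul_assoc]

end CFData

/-! ### From a factor map to a compatible telescoping -/

/-- The value `l 0 = 0` is forced, so the property can be arranged only for positive indices. -/
lemma exists_telescopingSeq {p : ℕ → ℕ → Prop} (h : ∀ k, ∃ᶠ n in atTop, p k n) :
    ∃ l, IsTelescopingSeq l ∧ ∀ k, 0 < k → p k (l k) := by
  obtain ⟨φ, hφ, hp⟩ := extraction_forall_of_frequently
    fun k => (h (k + 1)).and_eventually (eventually_gt_atTop 0)
  refine ⟨fun k => Nat.casesOn k 0 φ, ⟨rfl, strictMono_nat_of_lt_succ fun k => ?_⟩, ?_⟩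
  · cases k with
    | zero => exact (hp 0).2
    | succ k => exact hφ k.lt_succ_self
  · intro k hk
    cases k with
    | zero => exact absurd hk (lt_irrefl 0)
    | succ k => exact (hp k).1

lemma exists_frequently_eq {Q : Type*} [Finite Q] (j : ℕ → Q) : ∃ q, ∃ᶠ n in atTop, j n = q := by
  obtain ⟨q, hq⟩ := Finite.exists_infinite_fiber j
  exact ⟨q, Nat.frequently_atTop_iff_infinite.2 (Set.infinite_coe_iff.1 hq)⟩

namespace CFData

section BaseMap

variable {G : Type u} [Group G] [MeasurableSpace G] {D : CFData G} {Γ : Subgroup G}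

open Classical in
/-- The restriction of a map `τ` on `X` to the set `{1} × C_{n+1} × C_{n+2} × ⋯` of `X_n`. -/
noncomputable def baseMap (D : CFData G) (τ : D.Space → G ⧸ Γ) (n : ℕ) (c : ℕ → G) : G ⧸ Γ :=
  if h : (1, c) ∈ D.levelSet n then τ (D.incl n ⟨(1, c), h⟩) else (1 : G)

lemma baseMap_of_mem (τ : D.Space → G ⧸ Γ) {n : ℕ} {c : ℕ → G} (h : (1, c) ∈ D.levelSet n) :
    D.baseMap τ n c = τ (D.incl n ⟨(1, c), h⟩) := dif_pos h

end BaseMap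

variable {G : Type u} [Group G] [Countable G] [TopologicalSpace G] [DiscreteTopology G]
  [MeasurableSpace G] [BorelSpace G] {D : CFData G}

/-- The block `k = 0` needs no bound: it contributes at most the mass of a probability measure. -/
lemma Admissible.compatibleWith_telescope_of_le (hD : D.Admissible) {Γ : Subgroup G} {g : G}
    {l : ℕ → ℕ} (hl : IsTelescopingSeq l) {u : ℕ → ℝ≥0∞} (hu : ∑' k, u k ≠ ∞)
    (h : ∀ k, 0 < k → D.κprod (l k) (l (k + 1)) {c | c • (g : G ⧸ Γ) ≠ g} ≤ u k) :
    (D.telescope l hl).CompatibleWith Γ g := by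
  rw [hD.compatibleWith_telescope_iff]
  have := hD.isProbabilityMeasure_κprod (hl.strictMono (Nat.lt_succ_self 0)).le
  rw [tsum_eq_zero_add' ENNReal.summable, ENNReal.add_lt_top]
  refine ⟨measure_lt_top _ _, ?_⟩
  refine (ENNReal.tsum_le_tsum fun k => h (k + 1) k.succ_pos).trans_lt ?_
  exact (ENNReal.tsum_comp_le_tsum_of_injective (add_left_injective 1) u).trans_lt hu.lt_top

variable {Γ : Subgroup G}

lemma measurable_baseMap {τ : D.Space → G ⧸ Γ} (hτ : Measurable τ) (n : ℕ) :
    Measurable (D.baseMap τ n) := by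
  have hm : Measurable fun c : ℕ → G => ((1 : G), c) := by fun_prop
  classical
  refine Measurable.dite (s := {c | ((1 : G), c) ∈ D.levelSet n}) (f := fun c => τ (D.incl n ⟨(1, c.1), c.2⟩))
    (g := fun _ => ((1 : G) : G ⧸ Γ)) ?_ measurable_const (hm (D.measurableSet_levelSet n))
  exact hτ.comp ((measurableEmbedding_incl D.toCFSeq n).measurable.comp
    ((hm.comp measurable_subtype_coe).subtype_mk))

/-- Equivariance is applied to the group element `f` at the point `(1, c)`; this is legitimate for
almost every `c` because `1` is an atom of `ν n`. -/
lemma Admissible.ae_eq_smul_baseMap (hD : D.Admissible) {τ : D.Space → G ⧸ Γ}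
    (hτ : D.IsFactorMap τ) (n : ℕ) :
    ∀ᵐ c ∂D.seqMeasure n, ∀ (f : G) (h : (f, c) ∈ D.levelSet n),
      τ (D.incl n ⟨(f, c), h⟩) = f • D.baseMap τ n c := by
  have h1 := hD.ae_μ_iff.1 (hD.ae_mem_fullDomain.and (ae_all_iff.2 hτ.2)) n
  filter_upwards [hD.ae_seqMeasure_of_ae h1 (D.one_mem_F n)] with c hc f h
  have h0 : ((1 : G), c) ∈ D.levelSet n := ⟨D.one_mem_F n, h.2⟩
  obtain ⟨hx, hg⟩ := hc h0
  have h2 := hg f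
  rw [D.act_incl f _ hx (by simpa using! h.1)] at h2
  rw [baseMap_of_mem τ h0, ← h2]
  simp only [mul_one]

lemma Admissible.ae_baseMap_eq (hD : D.Admissible) {τ : D.Space → G ⧸ Γ}
    (hτ : D.IsFactorMap τ) (n k : ℕ) :
    ∀ᵐ c ∂D.seqMeasure n,
      D.baseMap τ n c = listProd c 0 k • D.baseMap τ (n + k) (fun i => c (k + i)) := by
  filter_upwards [hD.ae_mem_C n, (hD.measurePreserving_shift n k).quasiMeasurePreserving.ae
    (hD.ae_eq_smul_baseMap hτ (n + k))] with c hc h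
  have h0 : ((1 : G), c) ∈ D.levelSet n := ⟨D.one_mem_F n, hc⟩
  have h1 := D.advance_mem_levelSet h0 k
  rw [← one_mul (listProd c 0 k), ← h _ h1, baseMap_of_mem τ h0]
  exact congrArg τ (D.incl_advance ⟨_, h0⟩ k).symm

variable [Γ.FiniteIndex]

/-- For a factor map `τ` and large `n`, the map `baseMap τ n` is constant up to a set of small
measure. -/
lemma Admissible.exists_tendsto_baseMap_ne (hD : D.Admissible) {τ : D.Space → G ⧸ Γ}
    (hτ : D.IsFactorMap τ) :
    ∃ j : ℕ → G ⧸ Γ, Tendsto (fun n => D.seqMeasure n {c | D.baseMap τ n c ≠ j n}) atTop (𝓝 0) := by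
  have := hD.prob_κ
  have := hD.isProbabilityMeasure_seqMeasure
  have hm := measurable_baseMap hτ.1
  have hlim : Tendsto (fun m => ((D.seqMeasure 0).prod (D.seqMeasure m))
      {p | D.baseMap τ 0 (splice m p.1 p.2) ≠ D.baseMap τ 0 p.1}) atTop (𝓝 0) := by
    simpa only [seqMeasure, zero_add] using tendsto_measure_splice_ne D.κ (hm 0)
  suffices ∀ m, ∃ j, D.seqMeasure m {c | D.baseMap τ m c ≠ j} ≤
      ((D.seqMeasure 0).prod (D.seqMeasure m))
        {p | D.baseMap τ 0 (splice m p.1 p.2) ≠ D.baseMap τ 0 p.1} by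
    choose j hj using this
    exact ⟨j, tendsto_of_tendsto_of_tendsto_of_le_of_le tendsto_const_nhds hlim
      (fun _ => zero_le) hj⟩
  intro m
  have hae : ∀ᵐ c ∂D.seqMeasure 0, D.baseMap τ 0 c =
      listProd c 0 m • D.baseMap τ m (fun i => c (m + i)) := by
    simpa only [zero_add] using hD.ae_baseMap_eq hτ 0 m
  have hspl : MeasurePreserving (fun p : (ℕ → G) × (ℕ → G) => splice m p.1 p.2)
      ((D.seqMeasure 0).prod (D.seqMeasure m)) (D.seqMeasure 0) := by
    simpa only [seqMeasure, zero_add] using measurePreserving_splice D.κ m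
  let E : Set ((ℕ → G) × (ℕ → G)) :=
    {p | D.baseMap τ m p.2 ≠ D.baseMap τ m (fun i => p.1 (m + i))}
  have hE : MeasurableSet E :=
    (measurableSet_eq_fun ((hm m).comp measurable_snd) ((hm m).comp (by fun_prop))).compl
  -- Both values of `baseMap τ 0` carry the same left factor, the product of the first `m` entries
  -- of `p.1`; cancelling it leaves `baseMap τ m` at two independent tails.
  have hcongr : ({p | D.baseMap τ 0 (splice m p.1 p.2) ≠ D.baseMap τ 0 p.1} :
      Set ((ℕ → G) × (ℕ → G))) =ᵐ[(D.seqMeasure 0).prod (D.seqMeasure m)] E := by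
    filter_upwards [hspl.quasiMeasurePreserving.ae hae,
      Measure.quasiMeasurePreserving_fst.ae hae] with p h1 h2
    have e1 : listProd (splice m p.1 p.2) 0 m = listProd p.1 0 m := by
      unfold listProd
      congr 1
      refine List.map_congr_left fun i hi => splice_of_lt ?_ _ _
      simpa using hi
    refine propext (not_congr ?_)
    rw [h1, h2, e1, smul_left_cancel_iff]
    simp only [splice_add]
  rw [measure_congr hcongr, Measure.prod_apply hE]
  -- Some slice has measure at most the average, and the value of `baseMap τ m` at the tail of this
  -- `c` serves as the constant.
  obtain ⟨c, hc⟩ := exists_le_lintegral (measurable_measure_prodMk_left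
    (ν := D.seqMeasure m) hE).aemeasurable (μ := D.seqMeasure 0)
  exact ⟨D.baseMap τ m fun i => c (m + i), hc⟩

/-- If `baseMap` takes the value `i` at `c` and `j` at its tail, then the product of the entries in
between maps `j` to `i`. -/
lemma Admissible.κprod_smul_ne_le (hD : D.Admissible) {τ : D.Space → G ⧸ Γ}
    (hτ : D.IsFactorMap τ) {n m : ℕ} (h : n ≤ m) (i j : G ⧸ Γ) :
    D.κprod n m {c | c • j ≠ i} ≤ D.seqMeasure n {c | D.baseMap τ n c ≠ i} +
      D.seqMeasure m {c | D.baseMap τ m c ≠ j} := by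
  obtain ⟨k, rfl⟩ := Nat.exists_eq_add_of_le h
  have hm := measurable_baseMap hτ.1 (n + k)
  rw [← (hD.measurePreserving_listProd n k).measure_preimage
      MeasurableSet.of_discrete.nullMeasurableSet,
    ← (hD.measurePreserving_shift n k).measure_preimage
      (s := {c | D.baseMap τ (n + k) c ≠ j}) (hm (measurableSet_singleton j)).compl.nullMeasurableSet]
  refine (measure_mono_ae ?_).trans (measure_union_le _ _)
  filter_upwards [hD.ae_baseMap_eq hτ n k] with c hc h1
  by_contra hcon
  have h2 : D.baseMap τ n c = i := by_contra fun hn => hcon (.inl hn)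
  have h3 : D.baseMap τ (n + k) (fun m => c (k + m)) = j := by_contra fun hn => hcon (.inr hn)
  exact h1 (by rw [← h2, hc, h3])

lemma Admissible.exists_compatibleWith_ae_eq (hD : D.Admissible) {τ : D.Space → G ⧸ Γ}
    (hτ : D.IsFactorMap τ) :
    ∃ (g : G) (l : ℕ → ℕ) (hl : IsTelescopingSeq l), (D.telescope l hl).CompatibleWith Γ g ∧
      τ =ᵐ[D.μ] fun x => (D.telescope l hl).factorMap (g : G ⧸ Γ) (D.iota l hl x) := by
  obtain ⟨j, hj⟩ := hD.exists_tendsto_baseMap_ne hτ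
  obtain ⟨q, hq⟩ := exists_frequently_eq j
  obtain ⟨g, rfl⟩ := QuotientGroup.mk_surjective q
  obtain ⟨ε, hε, hsum⟩ := ENNReal.exists_pos_sum_of_countable one_ne_zero ℕ
  have hsum' : ∑' k, (ε k : ℝ≥0∞) ≠ ∞ := (hsum.trans ENNReal.one_lt_top).ne
  -- Along `l` the almost constant value is always `g Γ` and the errors are summable; a block from
  -- `l k` to `l (k + 1)` then costs `ε k + ε (k + 1)`.
  obtain ⟨l, hl, hp⟩ := exists_telescopingSeq fun k => hq.and_eventually
    (ENNReal.tendsto_nhds_zero.1 hj (ε k) (by exact_mod_cast hε k))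
  have hle : ∀ k, 0 < k → D.seqMeasure (l k) {c | D.baseMap τ (l k) c ≠ g} ≤ ε k := fun k hk => by
    rw [← (hp k hk).1]
    exact (hp k hk).2
  refine ⟨g, l, hl, ?_, ?_⟩
  · refine hD.compatibleWith_telescope_of_le hl (u := fun k => ε k + ε (k + 1)) ?_ fun k hk =>
      (hD.κprod_smul_ne_le hτ (hl.strictMono k.lt_succ_self).le g g).trans
        (add_le_add (hle k hk) (hle (k + 1) k.succ_pos))
    rw [ENNReal.tsum_add]
    exact ENNReal.add_ne_top.2 ⟨hsum', ne_top_of_le_ne_top hsum'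
      (ENNReal.tsum_comp_le_tsum_of_injective (add_left_injective 1) fun k => (ε k : ℝ≥0∞))⟩
  · refine hD.ae_μ_iff.2 fun n => ?_
    -- By Borel–Cantelli, almost surely `baseMap τ (l k)` equals `g Γ` at the tail for all large
    -- `k`; then `τ` is the `l k`-th partial product applied to `g Γ`.
    have hs : ∑' k, D.seqMeasure n {c | (0 < k ∧ n ≤ l k) ∧
        D.baseMap τ (l k) (fun i => c (l k - n + i)) ≠ g} ≠ ∞ := by
      refine ne_top_of_le_ne_top hsum' (ENNReal.tsum_le_tsum fun k => ?_)
      by_cases hk : 0 < k ∧ n ≤ l k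
      · obtain ⟨a, ha⟩ := Nat.exists_eq_add_of_le hk.2
        refine le_trans ?_ (hle k hk.1)
        simp only [hk, true_and, and_self]
        rw [ha, Nat.add_sub_cancel_left]
        exact ((hD.measurePreserving_shift n a).measure_preimage
          (measurable_baseMap hτ.1 (n + a) (measurableSet_singleton _)).compl.nullMeasurableSet).le
      · simp [hk]
    filter_upwards [hD.ae_prodMeasure_snd (ae_eventually_notMem hs),
      hD.ae_prodMeasure_snd (hD.ae_eq_smul_baseMap hτ n),
      hD.ae_prodMeasure_snd (ae_all_iff.2 (hD.ae_baseMap_eq hτ n))] with p h1 h2 h3 h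
    refine (CFSeq.factorMap_eq _ ?_).symm
    refine (D.isFactorValue_iota_incl_iff _ l hl ⟨p, h⟩ _).2 ?_
    filter_upwards [h1, eventually_gt_atTop 0,
      hl.strictMono.tendsto_atTop.eventually (eventually_ge_atTop n)] with k h4 h5 h6
    have h7 : D.baseMap τ (l k) (fun i => p.2 (l k - n + i)) = g := by
      by_contra hne
      exact h4 ⟨⟨h5, h6⟩, hne⟩
    have h8 := h3 (l k - n)
    rw [Nat.add_sub_cancel' h6, h7] at h8
    rw [h2 p.1 h, h8, smul_smul]

end CFData

/-! ### The theorem -/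

theorem theorem2p3 {G : Type u} [Group G] [Countable G] [Infinite G]
    [TopologicalSpace G] [DiscreteTopology G] [MeasurableSpace G] [BorelSpace G]
    (D : CFData G) (hD : D.Admissible)
    (hfin : ∃ L < ∞, Tendsto (fun n => D.ν n (D.F n)) atTop (𝓝 L))
    (Γ : Subgroup G) [Γ.FiniteIndex] :
    List.TFAE [
      ∃ τ : D.Space → G ⧸ Γ, D.IsFactorMap τ,
      ∃ g : ℕ → G, Tendsto (fun N : ℕ => ⨆ (n : ℕ) (m : ℕ) (_ : N ≤ n) (_ : n < m),
        D.κprod n m {c ∈ D.Cprod n m | c ∉ ({(g n)⁻¹} * (Γ : Set G) * {g m} : Set G)})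
        atTop (𝓝 0),
      ∃ (g₀ : G) (l : ℕ → ℕ) (hl : IsTelescopingSeq l),
        (D.telescope l hl).CompatibleWith Γ g₀] ∧
    (∀ (g₀ : G) (l : ℕ → ℕ) (hl : IsTelescopingSeq l),
      (D.telescope l hl).CompatibleWith Γ g₀ →
        (∀ᵐ x ∂D.μ, ∃ j, (D.telescope l hl).IsFactorValue (g₀ : G ⧸ Γ) (D.iota l hl x) j) ∧
        D.IsFactorMap fun x => (D.telescope l hl).factorMap (g₀ : G ⧸ Γ) (D.iota l hl x)) ∧
    (∀ τ : D.Space → G ⧸ Γ, D.IsFactorMap τ →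
      ∃ (g₀ : G) (l : ℕ → ℕ) (hl : IsTelescopingSeq l),
        (D.telescope l hl).CompatibleWith Γ g₀ ∧
        τ =ᵐ[D.μ] fun x => (D.telescope l hl).factorMap (g₀ : G ⧸ Γ) (D.iota l hl x)) ∧
    (¬ D.HasFactorIsomorphicTo Γ ↔
      ¬ ∃ (g : G) (l : ℕ → ℕ) (hl : IsTelescopingSeq l),
        (D.telescope l hl).CompatibleWith (Γ.map (MulAut.conj g).toMonoidHom) 1) := by
  have hsmul : ∀ (g : ℕ → G) {n m : ℕ}, n ≤ m →
      D.κprod n m {c ∈ D.Cprod n m | c ∉ ({(g n)⁻¹} * (Γ : Set G) * {g m} : Set G)} =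
        D.κprod n m {c | c • (((g m)⁻¹ : G) : G ⧸ Γ) ≠ (((g n)⁻¹ : G) : G ⧸ Γ)} := by
    intro g n m h
    simp only [mem_conj_mul_iff]
    exact hD.κprod_sep h _
  have h31 : (∃ (g₀ : G) (l : ℕ → ℕ) (hl : IsTelescopingSeq l),
      (D.telescope l hl).CompatibleWith Γ g₀) → ∃ τ : D.Space → G ⧸ Γ, D.IsFactorMap τ :=
    fun ⟨_, _, _, hc⟩ => ⟨_, hD.isFactorMap_factorMap_iota hc⟩
  refine ⟨?_, fun g₀ l hl hc => ⟨hD.ae_exists_isFactorValue hc, hD.isFactorMap_factorMap_iota hc⟩,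
    fun τ hτ => hD.exists_compatibleWith_ae_eq hτ, not_congr ?_⟩
  · tfae_have 1 → 2 := by
      rintro ⟨τ, hτ⟩
      obtain ⟨j, hj⟩ := hD.exists_tendsto_baseMap_ne hτ
      choose a ha using fun n => QuotientGroup.mk_surjective (s := Γ) (j n)
      -- The set `g_n⁻¹ Γ g_m` consists of the elements mapping `g_m⁻¹ Γ` to `g_n⁻¹ Γ`, so
      -- representatives of the `j n` enter inverted.
      refine ⟨fun n => (a n)⁻¹, ENNReal.tendsto_nhds_zero.2 fun ε hε => ?_⟩
      have h1 := ENNReal.tendsto_nhds_zero.1 hj (ε / 2) (ENNReal.half_pos hε.ne')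
      filter_upwards [eventually_forall_ge_atTop.2 h1] with N hN
      refine iSup_le fun n => iSup_le fun m => iSup_le fun hn => iSup_le fun hnm => ?_
      rw [hsmul (fun n => (a n)⁻¹) hnm.le]
      simp only [inv_inv, ha]
      calc _ ≤ _ := hD.κprod_smul_ne_le hτ hnm.le (j n) (j m)
        _ ≤ ε / 2 + ε / 2 := add_le_add (hN n hn) (hN m (hn.trans hnm.le))
        _ = ε := ENNReal.add_halves ε
    tfae_have 2 → 3 := by
      rintro ⟨g, hg⟩
      obtain ⟨q, hq⟩ := exists_frequently_eq fun n => (((g n)⁻¹ : G) : G ⧸ Γ)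
      obtain ⟨g₀, rfl⟩ := QuotientGroup.mk_surjective q
      obtain ⟨ε, hε, hsum⟩ := ENNReal.exists_pos_sum_of_countable one_ne_zero ℕ
      obtain ⟨l, hl, hp⟩ := exists_telescopingSeq fun k => hq.and_eventually
        -- The supremum at `N = l k` already covers the pair `(l k, l (k + 1))`, so the `k`-th block
        -- is bounded by `ε k`.
        (ENNReal.tendsto_nhds_zero.1 hg (ε k) (by exact_mod_cast hε k))
      refine ⟨g₀, l, hl, hD.compatibleWith_telescope_of_le hl (hsum.trans ENNReal.one_lt_top).ne
        fun k hk => le_trans ?_ (hp k hk).2⟩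
      have hlt := hl.strictMono k.lt_succ_self
      have h := hsmul g hlt.le
      rw [(hp k hk).1, (hp (k + 1) k.succ_pos).1] at h
      rw [← h]
      exact le_iSup_of_le (l k) (le_iSup_of_le (l (k + 1)) (le_iSup_of_le le_rfl
        (le_iSup_of_le hlt le_rfl)))
    tfae_have 3 → 1 := h31
    tfae_finish
  · have hconj : ∀ (g : G) (E : CFData G),
        E.CompatibleWith (Γ.map (MulAut.conj g).toMonoidHom) 1 ↔ E.CompatibleWith Γ g := by
      intro g E
      have e : (Γ.map (MulAut.conj g).toMonoidHom).map (MulAut.conj (1 : G)).toMonoidHom =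
          Γ.map (MulAut.conj g).toMonoidHom := by
        rw [map_one]
        exact Subgroup.map_id _
      simp only [CFData.CompatibleWith, e]
    simp only [hconj]
    constructor
    · rintro ⟨Y, _, _, φ, e, hφ, he⟩
      have hτ : D.IsFactorMap (e ∘ φ) := by
        refine ⟨e.measurable.comp hφ.1, fun g => ?_⟩
        filter_upwards [hφ.2 g] with x hx
        simp only [Function.comp_apply, hx, he]
      obtain ⟨g, l, hl, hc, -⟩ := hD.exists_compatibleWith_ae_eq hτ
      exact ⟨g, l, hl, hc⟩
    · intro h
      obtain ⟨τ, hτ⟩ := h31 h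
      exact ⟨G ⧸ Γ, inferInstance, inferInstance, τ, MeasurableEquiv.refl _, hτ, fun _ _ => rfl⟩
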